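/- Let $\mathbf z$ be a (finite or infinite) formal product of primes from a set; for each prime $x\mid\mathbf z$ let $\mathbf z(x)$ be the $x$-part of $\mathbf z$ and let $G_{\mathbf z(x)}$ be a finite cyclic group with generator $\sigma_{\mathbf z(x)}$. A stalk of $\mathbf z$ is a product $z$ of some of the $\mathbf z(x)$ (finite if there are finitely many factors); for a set $y$ of primes dividing $\mathbf z$, identified with the squarefree formal product of its elements, $\mathbf z(y)$ is the stalk $\prod_{x\mid y}\mathbf z(x)$. For a stalk $z$ put $G_z=\prod_{x\mid z}G_{\mathbf z(x)}$, and let $G=G_{\mathbf z}$. For each $x\mid\mathbf z$ an element $\mathrm{Fr}_x\in G$ is given. Let $\mathcal O$ be an integral domain, let $\mathcal T$ be a commutative $\mathcal O$-algebra that is finitely generated and torsion free as an $\mathcal O$-module, and for each $x\mid\mathbf z$ let $p(x;t)\in\mathcal T[t]$. For a stalk $z$, let $\mathcal A_z$ be the free $\mathcal T$-module on the symbols $[g\,z']$, where $z'$ is a finite stalk of $\mathbf z$ dividing $z$ and $g\in G_{z'}$. The group $G$ acts on $\mathcal A_z$ by $h\cdot[g\,z']=[h_{z'}g\,z']$, where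 $h_{z'}$ is the projection of $h$ to $G_{z'}$. Let $N_{\mathbf z(x)}=\sum_{g\in G_{\mathbf z(x)}}g$, and let $\mathcal D_z\subseteq\mathcal A_z$ be the $\mathcal T[G]$-submodule generated by all elements $$p(x;\mathrm{Fr}_x^{-1})[z']-N_{\mathbf z(x)}[\mathbf z(x)z'],\qquad x\mid z,\ x\nmid z',\ z' \text{ a finite stalk of } \mathbf z \text{ dividing } z.$$ The universal norm distribution of level $z$ is $\mathcal U_z=\mathcal A_z/\mathcal D_z$; write $\mathcal U=\mathcal U_{\mathbf z}$. Let $M\in\mathcal O$ and, for each $x\mid\mathbf z$, let $r_x(t)\in\mathcal O[t]$. Assume that for every $x\mid\mathbf z$: (i) $M$ divides $|G_{\mathbf z(x)}|$ in $\mathcal O$ and $M$ divides $p(x;1)$ in $\mathcal T$; (ii) the endomorphism $\gamma_{\mathbf z(x)}=p(x;\mathrm{Fr}_x^{-1})-r_x(\mathrm{Fr}_x^{-1})\,|G_{\mathbf z(x)}|$ of $\mathcal U_{\mathbf z/\mathbf z(x)}$ is injective. For $x\mid\mathbf z$ let $D_{\mathbf z(x)}=\sum_{k=0}^{|G_{\mathbf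 z(x)}|-1}k\,\sigma_{\mathbf z(x)}^k\in\mathcal T[G]$, and for $y$ finite squarefree dividing $\mathbf z$ let $D_y=\prod_{x\mid y}D_{\mathbf z(x)}$. **Theorem.** For every finite squarefree $y\mid\mathbf z$ the class $\bar c'_y=D_y[\mathbf z(y)]\bmod M\mathcal U$ lies in $H^0(G,\mathcal U/M\mathcal U)=(\mathcal U/M\mathcal U)^G$, and the family $\{\bar c'_y : y \text{ finite squarefree},\ y\mid\mathbf z\}$ is a basis of $H^0(G,\mathcal U/M\mathcal U)$ as a module over $\mathcal T/M\mathcal T$. -/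

import Mathlib

/-! Universal norm distributions.

A formal product `𝐳` of primes is fixed throughout.  `X` is the set of primes dividing `𝐳`, and
`G x` is the finite abelian group `G_{𝐳(x)}` attached to the `x`-part `𝐳(x)` of `𝐳`; the set `X`
may be finite or infinite.  A stalk `z ∣_s 𝐳` is determined by its support, so stalks of `𝐳` are
encoded as subsets `S` of `X` and finite stalks as finite subsets of `X`.  In particular a finite
squarefree `y ∣ 𝐳` is a `Finset X`, the stalk `𝐳(y)` is encoded by the same finset, the stalk
`𝐳 / 𝐳(x)` is `{x}ᶜ`, and `𝐳` itself is `Set.univ`. -/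

namespace NormDist

/-- The group `G_𝐳`: the direct product of the groups `G_{𝐳(x)}` over all primes `x ∣ 𝐳`. -/
abbrev Grp {X : Type*} (G : X → Type*) : Type _ := ∀ x, G x

/-- The basis `A_z` of `𝒜_z`: symbols `[g z']`, where `z'` is a finite stalk of the stalk `z`
with support `S`, and `g ∈ G_{z'} = ∏_{x ∣ z'} G_{𝐳(x)}`. -/
structure Symb {X : Type*} (G : X → Type*) (S : Set X) where
  supp : Finset X
  supp_sub : (supp : Set X) ⊆ S
  elt : ∀ x : supp, G x

section

variable {X : Type*} {G : X → Type*} [∀ x, CommGroup (G x)]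

/-- The action `g ⬝ [g'' z''] = [g_{z''} g'' z'']` of `G_𝐳` on symbols, where `g_{z''}` is the
restriction of `g` to `G_{z''}`. -/
instance (S : Set X) : MulAction (Grp G) (Symb G S) where
  smul g a := ⟨a.supp, a.supp_sub, fun x => g x * a.elt x⟩
  one_smul a := by
    show Symb.mk _ _ _ = a
    simp
  mul_smul g h a := by
    show Symb.mk _ _ _ = Symb.mk _ _ _
    congr 1
    funext x
    exact mul_assoc _ _ _

end

noncomputable section

variable (T : Type*) [CommRing T] {X : Type*} (G : X → Type*) [∀ x, CommGroup (G x)]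

/-- The free `T`-module `𝒜_z` on the symbols `[g z']`. -/
abbrev A (S : Set X) : Type _ := Symb G S →₀ T

/-- The action of `G_𝐳` on `𝒜_z`. -/
def repA (S : Set X) : Representation T (Grp G) (A T G S) where
  toFun g := Finsupp.lmapDomain T T (g • ·)
  map_one' := by ext; simp
  map_mul' g h := by ext; simp [mul_smul]

/-- The symbol `[g z'] ∈ 𝒜_z`, for `z'` a finite stalk with support `s ⊆ S` and `g ∈ G_𝐳`
(restricted to `G_{z'}`). -/
def sym {S : Set X} (s : Finset X) (hs : (s : Set X) ⊆ S) (g : Grp G) : A T G S :=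
  Finsupp.single ⟨s, hs, fun x => g x⟩ 1

/-- The group element `g ∈ G_𝐳` in the group ring `T[G_𝐳]`. -/
abbrev grpElt (g : Grp G) : MonoidAlgebra T (Grp G) := MonoidAlgebra.of T (Grp G) g

variable {T} {G}

theorem repA_sym (S : Set X) (s : Finset X) (hs : (s : Set X) ⊆ S) (g h : Grp G) :
    repA T G S h (sym T G s hs g) = sym T G s hs (h * g) := by
  simp only [repA, sym, MonoidHom.coe_mk, OneHom.coe_mk, Finsupp.lmapDomain_apply,
    Finsupp.mapDomain_single]
  rfl

theorem repA_asAlgebraHom (S : Set X) (f : MonoidAlgebra T (Grp G)) (g : Grp G) (a : A T G S) :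
    repA T G S g ((repA T G S).asAlgebraHom f a) =
      (repA T G S).asAlgebraHom f (repA T G S g a) := by
  have h : repA T G S g = (repA T G S).asAlgebraHom (MonoidAlgebra.of T (Grp G) g) := by
    simp
  rw [h, ← Module.End.mul_apply, ← Module.End.mul_apply, ← map_mul, ← map_mul, mul_comm]

variable (T) (G)

variable [DecidableEq X] [∀ x, Fintype (G x)]

/-- The norm element `N_{𝐳(x)} = ∑_{h ∈ G_{𝐳(x)}} h` of `T[G_𝐳]`. -/
def normElt (x : X) : MonoidAlgebra T (Grp G) :=
  ∑ h : G x, grpElt T G (Pi.mulSingle x h)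

variable {G}

/-- The Kolyvagin derivative operator `D_{𝐳(x)} = ∑_{k < |G_{𝐳(x)}|} k σ_{𝐳(x)}^k` in `T[G_𝐳]`. -/
def kolyD (σ : ∀ x, G x) (x : X) : MonoidAlgebra T (Grp G) :=
  ∑ k ∈ Finset.range (Fintype.card (G x)), k • grpElt T G (Pi.mulSingle x (σ x)) ^ k

/-- The product `D_y = ∏_{x ∣ y} D_{𝐳(x)}` in the commutative ring `T[G_𝐳]`. -/
def kolyDProd (σ : ∀ x, G x) (y : Finset X) : MonoidAlgebra T (Grp G) :=
  ∏ x ∈ y, kolyD T σ x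

variable {T}

/-- `f(Fr_x⁻¹) ∈ T[G_𝐳]` for a polynomial `f` over `T`. -/
def evalFrob (Fr : X → Grp G) (x : X) (f : Polynomial T) : MonoidAlgebra T (Grp G) :=
  Polynomial.aeval (grpElt T G (Fr x)⁻¹) f

/-- `λ_{𝐳(x)} [g z'] = p(x; Fr_x⁻¹) [g z'] - N_{𝐳(x)} [g 𝐳(x) z'] ∈ 𝒜_z`, for `x ∣ z` and
`z'` a finite stalk of `z` not divisible by `x`. -/
def lam (p : X → Polynomial T) (Fr : X → Grp G) {S : Set X} (x : X) (hx : x ∈ S)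
    (s : Finset X) (hs : (s : Set X) ⊆ S) (g : Grp G) : A T G S :=
  (repA T G S).asAlgebraHom (evalFrob Fr x (p x)) (sym T G s hs g) -
    (repA T G S).asAlgebraHom (normElt T G x)
      (sym T G (insert x s) (by rw [Finset.coe_insert]; exact Set.insert_subset hx hs) g)

/-- `𝒟_z`: the sum of the images `λ_{𝐳(x)}(𝒜_{z/𝐳(x)})` over all `x ∣ z`. -/
def relD (p : X → Polynomial T) (Fr : X → Grp G) (S : Set X) : Submodule T (A T G S) :=
  Submodule.span T {a | ∃ (x : X) (hx : x ∈ S) (s : Finset X) (hs : (s : Set X) ⊆ S)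
    (g : Grp G), x ∉ s ∧ a = lam p Fr x hx s hs g}

/-- `𝒟_z` is stable under `G_𝐳`. -/
theorem relD_le_comap (p : X → Polynomial T) (Fr : X → Grp G) (S : Set X) (g : Grp G) :
    relD p Fr S ≤ (relD p Fr S).comap (repA T G S g) := by
  refine Submodule.span_le.2 ?_
  rintro _ ⟨x, hx, s, hs, h, hxs, rfl⟩
  refine Submodule.subset_span ⟨x, hx, s, hs, g * h, hxs, ?_⟩
  simp only [lam, map_sub, repA_asAlgebraHom, repA_sym]

/-- The universal norm distribution `𝒰_z = 𝒜_z / 𝒟_z`. -/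
abbrev U (p : X → Polynomial T) (Fr : X → Grp G) (S : Set X) : Type _ :=
  A T G S ⧸ relD p Fr S

/-- The action of `G_𝐳` on `𝒰_z`. -/
def repU (p : X → Polynomial T) (Fr : X → Grp G) (S : Set X) :
    Representation T (Grp G) (U p Fr S) :=
  (repA T G S).quotient (relD p Fr S) (relD_le_comap p Fr S)

/-- `γ_{𝐳(x)} = p(x; Fr_x⁻¹) - r(Fr_x⁻¹) |G_{𝐳(x)}|` as an endomorphism of `𝒰_{𝐳/𝐳(x)}`. -/
def gam {O : Type*} [CommRing O] [Algebra O T] (p : X → Polynomial T) (Fr : X → Grp G)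
    (r : Polynomial O) (x : X) : U p Fr {x}ᶜ →ₗ[T] U p Fr {x}ᶜ :=
  (repU p Fr {x}ᶜ).asAlgebraHom
    (evalFrob Fr x (p x) -
      (Fintype.card (G x) : MonoidAlgebra T (Grp G)) *
        evalFrob Fr x (r.map (algebraMap O T)))

/-- The ideal `M T` of `T`. -/
abbrev idl {O : Type*} [CommRing O] (T : Type*) [CommRing T] [Algebra O T] (M : O) : Ideal T :=
  Ideal.span {algebraMap O T M}

/-- `𝒰_𝐳 / M 𝒰_𝐳`, a module over `T / M T`. -/
abbrev UMod {O : Type*} [CommRing O] [Algebra O T] (p : X → Polynomial T) (Fr : X → Grp G)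
    (M : O) : Type _ :=
  U p Fr Set.univ ⧸ (idl T M • (⊤ : Submodule T (U p Fr Set.univ)))

/-- The action of `G_𝐳` on `𝒰_𝐳 / M 𝒰_𝐳`. -/
def repUMod {O : Type*} [CommRing O] [Algebra O T] (p : X → Polynomial T) (Fr : X → Grp G)
    (M : O) : Representation T (Grp G) (UMod p Fr M) :=
  (repU p Fr Set.univ).quotient _ fun g => by
    rw [← Submodule.map_le_iff_le_comap, Submodule.map_smul'']
    exact smul_mono_right _ le_top

/-- `H⁰(G_𝐳, 𝒰_𝐳 / M 𝒰_𝐳)`: the `G_𝐳`-invariants of `𝒰_𝐳 / M 𝒰_𝐳`, as a module over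
`T / M T`. -/
def H0 {O : Type*} [CommRing O] [Algebra O T] (p : X → Polynomial T) (Fr : X → Grp G) (M : O) :
    Submodule (T ⧸ idl T M) (UMod p Fr M) where
  carrier := (repUMod p Fr M).invariants
  add_mem' := (repUMod p Fr M).invariants.add_mem
  zero_mem' := (repUMod p Fr M).invariants.zero_mem
  smul_mem' c u hu := by
    obtain ⟨t, rfl⟩ := Ideal.Quotient.mk_surjective c
    exact (repUMod p Fr M).invariants.smul_mem t hu

/-- The class `D_y [𝐳(y)]` modulo `M 𝒰_𝐳`. -/
def kolyClass {O : Type*} [CommRing O] [Algebra O T] (p : X → Polynomial T) (Fr : X → Grp G)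
    (M : O) (σ : ∀ x, G x) (y : Finset X) : UMod p Fr M :=
  Submodule.Quotient.mk ((repU p Fr Set.univ).asAlgebraHom (kolyDProd T σ y)
    (Submodule.Quotient.mk (sym T G y (Set.subset_univ _) 1)))


end

end NormDist

/-! The invariants of `𝒰_𝐳 / M 𝒰_𝐳` are computed by peeling off one prime at a time.

Write `I` for the ideal of `T` generated by `M`.  For disjoint finite sets `S` and `Z` of primes,
consider the subquotient `Q(S, Z)` of `𝒰_𝐳 / M 𝒰_𝐳` presented by the symbols `[g z']` whose
support contains `Z` and is contained in `S ∪ Z`, with the distribution relations at the primes of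
`S` and the relations `N_{𝐳(z)} = 0` for `z ∈ Z`.  For `x ∉ S ∪ Z` there is a short exact sequence
`0 → Q(S, Z) → Q(S ∪ {x}, Z) → Q(S, Z ∪ {x}) → 0`, the second map being the projection onto the
symbols that involve `x`.  Taking invariants is left exact, and an induction on `S` reduces
everything to `Q(∅, Z) = ⨂_{z ∈ Z} (T/I)[G_{𝐳(z)}] / N_{𝐳(z)}`, whose invariants are free on the
class of `D_Z [𝐳(Z)]` (`exists_sub_smul_kap_mem`, `mem_of_smul_kap_mem`).  The classes
`D_w [𝐳(w)]` with `x ∈ w` lift the generators of the invariants of `Q(S, Z ∪ {x})`, and they are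
invariant because `(σ_{𝐳(x)} - 1) D_{𝐳(x)} = |G_{𝐳(x)}| - N_{𝐳(x)}` while both `|G_{𝐳(x)}|` and
`p(x; 1)` vanish modulo `M` (`rho_kap_sub_mem`).  Hence the sequence of invariants is exact on the
right as well, and the classes `D_w [𝐳(w)]` with `Z ⊆ w ⊆ S ∪ Z` form a basis of the invariants of
`Q(S, Z)` (`mem_span_kap_sup_rel`, `mem_of_sum_smul_kap_mem`).

The point that needs proof is the injectivity of `Q(S, Z) → Q(S ∪ {x}, Z)`
(`mem_rel_of_mem_rel_insert`): elements `N_{𝐳(x)} c` that are relations must come from `c` that are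
relations.  This is part of the acyclicity statement `nup_injective_and_exact`, proved by induction
on `S` together with the exactness of multiplication by `N_{𝐳(x)}` and `σ_{𝐳(x)} - 1`.  For the
induction the set `Y` of primes that every support contains is allowed to be larger than the set
`Z` of primes whose norm is killed.  At `S = ∅` everything is read off from the components at `x`.

All subquotients are handled as pairs of submodules `rel ≤ win` of the single module `𝒜_𝐳`, both
containing `I 𝒜_𝐳`.  The module `𝒰_𝐳 / M 𝒰_𝐳` itself is the union of the `Q(S, ∅)`, so an infinite
set of primes needs no separate argument. -/

namespace NormDist

noncomputable section

set_option linter.unusedSectionVars false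

section Operators

/-! ### Operators on symbols -/

variable {T : Type*} [CommRing T] {X : Type*} {G : X → Type*} [∀ x, CommGroup (G x)]

variable (T G) in
/-- The symbol `[g z']` of `𝒜_𝐳`, with `s` the support of `z'`. -/
abbrev sy (s : Finset X) (g : Grp G) : A T G Set.univ :=
  sym T G s (Set.subset_univ _) g

variable (T G) in
/-- The action of the group ring `T[G_𝐳]` on `𝒜_𝐳`. -/
abbrev act (f : MonoidAlgebra T (Grp G)) : Module.End T (A T G Set.univ) :=
  (repA T G Set.univ).asAlgebraHom f

variable (T G) in
/-- The action of the group `G_𝐳` on `𝒜_𝐳`. -/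
abbrev rho (g : Grp G) : Module.End T (A T G Set.univ) := repA T G Set.univ g

theorem sy_congr (s : Finset X) {g g' : Grp G} (h : ∀ x ∈ s, g x = g' x) :
    sy T G s g = sy T G s g' := by
  have : (fun x : s => g x) = fun x : s => g' x := funext fun x => h x x.2
  simp only [sy, sym, this]

theorem rho_sy (s : Finset X) (g h : Grp G) : rho T G h (sy T G s g) = sy T G s (h * g) :=
  repA_sym _ _ _ _ _

variable [DecidableEq X]

theorem exists_sy_eq_single (a : Symb G (Set.univ : Set X)) :
    Finsupp.single a (1 : T) =
      sy T G a.supp fun x => if h : x ∈ a.supp then a.elt ⟨x, h⟩ else 1 := by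
  obtain ⟨s, hs, e⟩ := a
  simp [sym]

/-- Linear maps out of `𝒜_𝐳` are determined by their values on symbols. -/
theorem hom_ext {N : Type*} [AddCommMonoid N] [Module T N] {f f' : A T G Set.univ →ₗ[T] N}
    (h : ∀ s g, f (sy T G s g) = f' (sy T G s g)) : f = f' := by
  refine Finsupp.lhom_ext' fun a => LinearMap.ext_ring ?_
  simp only [LinearMap.comp_apply, Finsupp.lsingle_apply]
  rw [exists_sy_eq_single]
  exact h _ _

theorem hom_congr {N : Type*} [AddCommMonoid N] [Module T N] {f f' : A T G Set.univ →ₗ[T] N}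
    (h : ∀ s g, f (sy T G s g) = f' (sy T G s g)) (a) : f a = f' a := by
  rw [hom_ext h]

/-- The linear map on `𝒜_𝐳` with prescribed values `F s g` on the symbols `[g z']`; it is
meaningful when `F s g` depends only on the restriction of `g` to `s` (see `liftSy_sy`). -/
def liftSy {N : Type*} [AddCommMonoid N] [Module T N] (F : Finset X → Grp G → N) :
    A T G Set.univ →ₗ[T] N :=
  Finsupp.linearCombination T fun a : Symb G (Set.univ : Set X) =>
    F a.supp fun x => if h : x ∈ a.supp then a.elt ⟨x, h⟩ else 1

theorem liftSy_sy {N : Type*} [AddCommMonoid N] [Module T N] (F : Finset X → Grp G → N)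
    (hF : ∀ s g g', (∀ x ∈ s, g x = g' x) → F s g = F s g') (s : Finset X) (g : Grp G) :
    liftSy (T := T) F (sy T G s g) = F s g := by
  simp only [liftSy, sy, sym, Finsupp.linearCombination_single, one_smul]
  exact hF _ _ _ fun x hx => by simp [hx]

variable (T) in
/-- The map `[g z'] ↦ [g' 𝐳(x) z']`, where `g'` extends `g` by the component `h` at `x`; it
vanishes on the symbols whose support contains `x`. -/
def up (x : X) (h : G x) : Module.End T (A T G Set.univ) :=
  liftSy fun s g => if x ∈ s then 0 else sy T G (insert x s) (Function.update g x h)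

open Classical in
variable (T) in
/-- The map that takes a symbol whose support contains `x` and whose component at `x` is `h` to
the symbol with `x` removed, and all other symbols to zero. -/
def sl (x : X) (h : G x) : Module.End T (A T G Set.univ) :=
  liftSy fun s g => if x ∈ s then (if g x = h then sy T G (s.erase x) g else 0) else 0

variable (T G) in
/-- The projection of `𝒜_𝐳` onto the span of the symbols whose support does not contain `x`. -/
def pr (x : X) : Module.End T (A T G Set.univ) :=
  liftSy fun s g => if x ∈ s then 0 else sy T G s g

variable (T G) in
/-- The map that removes `x` from the support of each symbol, that is the restriction
`G_{z'} → G_{z'/𝐳(x)}` on group elements. -/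
def res (x : X) : Module.End T (A T G Set.univ) :=
  liftSy fun s g => sy T G (s.erase x) g

theorem up_sy {x : X} {s : Finset X} (hx : x ∉ s) (h : G x) (g : Grp G) :
    up T x h (sy T G s g) = sy T G (insert x s) (Function.update g x h) := by
  rw [up, liftSy_sy, if_neg hx]
  intro s g g' hg
  split_ifs with hx
  · rfl
  · refine sy_congr _ fun y hy => ?_
    by_cases hyx : y = x
    · subst hyx; simp
    · simp [hyx, hg y (Finset.mem_of_mem_insert_of_ne hy hyx)]

theorem up_sy_mem {x : X} {s : Finset X} (hx : x ∈ s) (h : G x) (g : Grp G) :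
    up T x h (sy T G s g) = 0 := by
  rw [up, liftSy_sy, if_pos hx]
  intro s g g' hg
  split_ifs with hx
  · rfl
  · refine sy_congr _ fun y hy => ?_
    by_cases hyx : y = x
    · subst hyx; simp
    · simp [hyx, hg y (Finset.mem_of_mem_insert_of_ne hy hyx)]

open Classical in
theorem sl_sy (x : X) (h : G x) (s : Finset X) (g : Grp G) :
    sl T x h (sy T G s g) =
      if x ∈ s then (if g x = h then sy T G (s.erase x) g else 0) else 0 := by
  rw [sl, liftSy_sy]
  intro s g g' hg
  by_cases hx : x ∈ s
  · rw [if_pos hx, if_pos hx, hg x hx,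
      sy_congr (s.erase x) fun y hy => hg y (Finset.mem_of_mem_erase hy)]
  · rw [if_neg hx, if_neg hx]

theorem pr_sy {x : X} {s : Finset X} (hx : x ∉ s) (g : Grp G) :
    pr T G x (sy T G s g) = sy T G s g := by
  rw [pr, liftSy_sy, if_neg hx]
  intro s g g' hg
  rw [sy_congr s hg]

theorem pr_sy_mem {x : X} {s : Finset X} (hx : x ∈ s) (g : Grp G) :
    pr T G x (sy T G s g) = 0 := by
  rw [pr, liftSy_sy, if_pos hx]
  intro s g g' hg
  rw [sy_congr s hg]

theorem res_sy (x : X) (s : Finset X) (g : Grp G) :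
    res T G x (sy T G s g) = sy T G (s.erase x) g := by
  rw [res, liftSy_sy]
  exact fun s g g' hg => sy_congr _ fun y hy => hg y (Finset.mem_of_mem_erase hy)

/-! ### Equivariance of the operators -/

theorem act_single (g : Grp G) (a) : act T G (MonoidAlgebra.of T (Grp G) g) a = rho T G g a := by
  simp [act]

theorem act_comm_of_rho {L : Module.End T (A T G Set.univ)}
    (hL : ∀ g a, L (rho T G g a) = rho T G g (L a)) (f : MonoidAlgebra T (Grp G)) (a) :
    L (act T G f a) = act T G f (L a) := by
  induction f using MonoidAlgebra.induction_on with
  | of g => rw [act_single, act_single, hL]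
  | add f f' h h' => simp only [act, map_add, LinearMap.add_apply] at *; rw [h, h']
  | smul t f h => simp only [act, map_smul, LinearMap.smul_apply] at *; rw [h]

theorem act_comm (f f' : MonoidAlgebra T (Grp G)) (a) :
    act T G f (act T G f' a) = act T G f' (act T G f a) := by
  rw [act, ← Module.End.mul_apply, ← map_mul, mul_comm, map_mul, Module.End.mul_apply]

theorem act_mul (f f' : MonoidAlgebra T (Grp G)) (a) :
    act T G (f * f') a = act T G f (act T G f' a) := by
  rw [act, map_mul, Module.End.mul_apply]

theorem pr_act (x : X) (f : MonoidAlgebra T (Grp G)) (a) :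
    pr T G x (act T G f a) = act T G f (pr T G x a) := by
  refine act_comm_of_rho (fun g => hom_congr (f := pr T G x * rho T G g)
    (f' := rho T G g * pr T G x) fun s h => ?_) f a
  simp only [Module.End.mul_apply, rho_sy]
  by_cases hx : x ∈ s
  · simp [pr_sy_mem hx]
  · simp [pr_sy hx, rho_sy]

theorem res_act (x : X) (f : MonoidAlgebra T (Grp G)) (a) :
    res T G x (act T G f a) = act T G f (res T G x a) := by
  refine act_comm_of_rho (fun g => hom_congr (f := res T G x * rho T G g)
    (f' := rho T G g * res T G x) fun s h => ?_) f a
  simp only [Module.End.mul_apply, rho_sy, res_sy]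

theorem rho_up (x : X) (h : G x) (g : Grp G) (a) :
    rho T G g (up T x h a) = up T x (g x * h) (rho T G g a) := by
  refine hom_congr (f := rho T G g * up T x h) (f' := up T x (g x * h) * rho T G g)
    (fun s k => ?_) a
  simp only [Module.End.mul_apply, rho_sy]
  by_cases hx : x ∈ s
  · simp [up_sy_mem hx]
  · rw [up_sy hx, up_sy hx, rho_sy]
    refine sy_congr _ fun y _ => ?_
    by_cases hy : y = x
    · subst hy; simp
    · simp [hy]

theorem rho_sl (x : X) (h : G x) (g : Grp G) (a) :
    rho T G g (sl T x h a) = sl T x (g x * h) (rho T G g a) := by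
  refine hom_congr (f := rho T G g * sl T x h) (f' := sl T x (g x * h) * rho T G g)
    (fun s k => ?_) a
  simp only [Module.End.mul_apply, rho_sy, sl_sy, Pi.mul_apply]
  by_cases hx : x ∈ s <;> by_cases hk : k x = h <;> simp [hx, hk, rho_sy]

variable [∀ x, Fintype (G x)]

theorem act_normElt (x : X) (a) :
    act T G (normElt T G x) a = ∑ h : G x, rho T G (Pi.mulSingle x h) a := by
  simp [act, normElt]

theorem act_kolyD (σ : ∀ x, G x) (x : X) (a) :
    act T G (kolyD T σ x) a =
      ∑ k ∈ Finset.range (Fintype.card (G x)), k • rho T G (Pi.mulSingle x (σ x ^ k)) a := by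
  simp only [kolyD, act, map_sum, map_nsmul, LinearMap.sum_apply, LinearMap.smul_apply]
  refine Finset.sum_congr rfl fun k _ => ?_
  rw [← map_pow, ← Pi.mulSingle_pow]
  simp

variable (T G) in
/-- The `G_𝐳`-equivariant map `[g z'] ↦ N_{𝐳(x)} [g 𝐳(x) z']`, which vanishes on the symbols
whose support contains `x`. -/
def nup (x : X) : Module.End T (A T G Set.univ) := ∑ h : G x, up T x h

theorem nup_apply (x : X) (a) : nup T G x a = ∑ h : G x, up T x h a := by simp [nup]

theorem nup_sy_mem {x : X} {s : Finset X} (hx : x ∈ s) (g : Grp G) :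
    nup T G x (sy T G s g) = 0 := by
  simp [nup_apply, up_sy_mem hx]

theorem nup_sy {x : X} {s : Finset X} (hx : x ∉ s) (g : Grp G) :
    nup T G x (sy T G s g) = act T G (normElt T G x) (sy T G (insert x s) g) := by
  rw [nup_apply, act_normElt, ← Equiv.sum_comp (Equiv.mulRight (g x))]
  refine Finset.sum_congr rfl fun h _ => ?_
  rw [up_sy hx, rho_sy]
  refine sy_congr _ fun y _ => ?_
  by_cases hy : y = x
  · subst hy; simp
  · simp [hy]

theorem nup_act (x : X) (f : MonoidAlgebra T (Grp G)) (a) :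
    nup T G x (act T G f a) = act T G f (nup T G x a) := by
  refine act_comm_of_rho (fun g a => ?_) f a
  rw [nup_apply, nup_apply, map_sum, ← Equiv.sum_comp (Equiv.mulLeft (g x))]
  simp [rho_up]

/-- An operator commuting with the group elements trivial at `x` commutes with `N_{𝐳(z)}` and
`D_{𝐳(z)}` for `z ≠ x`. -/
theorem act_normElt_comm {L : Module.End T (A T G Set.univ)} {x z : X} (hz : z ≠ x)
    (hL : ∀ g : Grp G, g x = 1 → ∀ a, L (rho T G g a) = rho T G g (L a)) (a) :
    L (act T G (normElt T G z) a) = act T G (normElt T G z) (L a) := by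
  simp only [act_normElt, map_sum]
  refine Finset.sum_congr rfl fun h _ => hL _ ?_ _
  simp [hz.symm]

theorem act_kolyD_comm {L : Module.End T (A T G Set.univ)} {x z : X} (hz : z ≠ x)
    (hL : ∀ g : Grp G, g x = 1 → ∀ a, L (rho T G g a) = rho T G g (L a)) (σ : ∀ x, G x) (a) :
    L (act T G (kolyD T σ z) a) = act T G (kolyD T σ z) (L a) := by
  simp only [act_kolyD, map_sum, map_nsmul]
  refine Finset.sum_congr rfl fun k _ => ?_
  rw [hL _ (by simp [hz.symm])]

theorem act_kolyDProd_comm {L : Module.End T (A T G Set.univ)} {x : X}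
    (hL : ∀ g : Grp G, g x = 1 → ∀ a, L (rho T G g a) = rho T G g (L a)) (σ : ∀ x, G x)
    {y : Finset X} (hy : x ∉ y) (a) :
    L (act T G (kolyDProd T σ y) a) = act T G (kolyDProd T σ y) (L a) := by
  induction y using Finset.induction_on generalizing a with
  | empty => simp [kolyDProd, act]
  | insert z y hz ih =>
    have hxz : z ≠ x := fun h => hy (h ▸ Finset.mem_insert_self _ _)
    rw [kolyDProd, Finset.prod_insert hz, act_mul, act_mul, act_kolyD_comm hxz hL]
    congr 1
    exact ih (fun h => hy (Finset.mem_insert_of_mem h)) a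

theorem up_rho_of_eq_one {x : X} (h : G x) (g : Grp G) (hg : g x = 1) (a) :
    up T x h (rho T G g a) = rho T G g (up T x h a) := by
  rw [rho_up, hg, one_mul]

theorem sl_rho_of_eq_one {x : X} (h : G x) (g : Grp G) (hg : g x = 1) (a) :
    sl T x h (rho T G g a) = rho T G g (sl T x h a) := by
  rw [rho_sl, hg, one_mul]

/-! ### Relations between the operators -/

theorem pr_pr (x : X) (a) : pr T G x (pr T G x a) = pr T G x a := by
  refine hom_congr (f := pr T G x * pr T G x) (f' := pr T G x) (fun s g => ?_) a
  by_cases hx : x ∈ s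
  · simp [pr_sy_mem hx]
  · simp [pr_sy hx]

theorem pr_up (x : X) (h : G x) (a) : pr T G x (up T x h a) = 0 := by
  refine hom_congr (f := pr T G x * up T x h) (f' := 0) (fun s g => ?_) a
  by_cases hx : x ∈ s
  · simp [up_sy_mem hx]
  · simp [up_sy hx, pr_sy_mem (Finset.mem_insert_self x s)]

theorem pr_nup (x : X) (a) : pr T G x (nup T G x a) = 0 := by
  simp [nup_apply, pr_up]

theorem pr_up_comm {x y : X} (hxy : x ≠ y) (h : G y) (a) :
    pr T G x (up T y h a) = up T y h (pr T G x a) := by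
  refine hom_congr (f := pr T G x * up T y h) (f' := up T y h * pr T G x) (fun s g => ?_) a
  simp only [Module.End.mul_apply]
  by_cases hx : x ∈ s <;> by_cases hy : y ∈ s
  · simp [up_sy_mem hy, pr_sy_mem hx]
  · simp [up_sy hy, pr_sy_mem hx, pr_sy_mem (Finset.mem_insert_of_mem hx)]
  · simp [up_sy_mem hy, pr_sy hx]
  · have : x ∉ insert y s := by simp [hx, hxy]
    simp [up_sy hy, pr_sy hx, pr_sy this]

theorem pr_nup_comm {x y : X} (hxy : x ≠ y) (a) :
    pr T G x (nup T G y a) = nup T G y (pr T G x a) := by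
  simp [nup_apply, pr_up_comm hxy]

theorem up_up_comm {x y : X} (hxy : x ≠ y) (h : G x) (k : G y) (a) :
    up T x h (up T y k a) = up T y k (up T x h a) := by
  refine hom_congr (f := up T x h * up T y k) (f' := up T y k * up T x h) (fun s g => ?_) a
  simp only [Module.End.mul_apply]
  by_cases hx : x ∈ s <;> by_cases hy : y ∈ s
  · simp [up_sy_mem hy, up_sy_mem hx]
  · simp [up_sy hy, up_sy_mem hx, up_sy_mem (Finset.mem_insert_of_mem hx)]
  · simp [up_sy_mem hy, up_sy hx, up_sy_mem (Finset.mem_insert_of_mem hy)]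
  · have h1 : x ∉ insert y s := by simp [hx, hxy]
    have h2 : y ∉ insert x s := by simp [hy, hxy.symm]
    rw [up_sy hy, up_sy hx, up_sy h1, up_sy h2, Finset.insert_comm, Function.update_comm hxy.symm]

theorem nup_nup_comm {x y : X} (hxy : x ≠ y) (a) :
    nup T G x (nup T G y a) = nup T G y (nup T G x a) := by
  simp only [nup_apply, map_sum]
  rw [Finset.sum_comm]
  exact Finset.sum_congr rfl fun _ _ => Finset.sum_congr rfl fun _ _ => up_up_comm hxy _ _ _

theorem res_pr_comm {x y : X} (hxy : x ≠ y) (a) :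
    res T G x (pr T G y a) = pr T G y (res T G x a) := by
  refine hom_congr (f := res T G x * pr T G y) (f' := pr T G y * res T G x) (fun s g => ?_) a
  simp only [Module.End.mul_apply, res_sy]
  by_cases hy : y ∈ s
  · rw [pr_sy_mem hy, pr_sy_mem (by simp [hy, hxy.symm]), map_zero]
  · rw [pr_sy hy, pr_sy (by simp [hy]), res_sy]

theorem res_nup_comm {x y : X} (hxy : x ≠ y) (a) :
    res T G x (nup T G y a) = nup T G y (res T G x a) := by
  refine hom_congr (f := res T G x * nup T G y) (f' := nup T G y * res T G x) (fun s g => ?_) a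
  simp only [Module.End.mul_apply, res_sy]
  by_cases hy : y ∈ s
  · rw [nup_sy_mem hy, nup_sy_mem (by simp [hy, hxy.symm]), map_zero]
  · rw [nup_sy hy, nup_sy (by simp [hy]), res_act, res_sy, Finset.erase_insert_of_ne hxy.symm]

theorem sl_up (x : X) (h : G x) (a) : sl T x h (up T x h a) = pr T G x a := by
  refine hom_congr (f := sl T x h * up T x h) (f' := pr T G x) (fun s g => ?_) a
  simp only [Module.End.mul_apply]
  by_cases hx : x ∈ s
  · simp [up_sy_mem hx, pr_sy_mem hx]
  · rw [up_sy hx, pr_sy hx, sl_sy]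
    simp only [Finset.mem_insert_self, if_true, Function.update_self, Finset.erase_insert hx]
    refine sy_congr _ fun y hy => ?_
    rw [Function.update_of_ne]
    rintro rfl
    exact hx hy

theorem sl_up_of_ne {x : X} {h k : G x} (hk : k ≠ h) (a) : sl T x h (up T x k a) = 0 := by
  refine hom_congr (f := sl T x h * up T x k) (f' := 0) (fun s g => ?_) a
  simp only [Module.End.mul_apply]
  by_cases hx : x ∈ s
  · simp [up_sy_mem hx]
  · rw [up_sy hx, sl_sy]
    simp [hk]

theorem sl_nup (x : X) (h : G x) (a) : sl T x h (nup T G x a) = pr T G x a := by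
  rw [nup_apply, map_sum, Finset.sum_eq_single h, sl_up]
  · exact fun k _ hk => sl_up_of_ne hk a
  · simp

/-- The decomposition of `𝒜_𝐳` according to the component at `x`. -/
theorem pr_add_sum_up_sl (x : X) (a) :
    pr T G x a + ∑ h : G x, up T x h (sl T x h a) = a := by
  have := hom_congr (f := pr T G x + ∑ h : G x, up T x h * sl T x h) (f' := 1) (fun s g => ?_) a
  · simpa using this
  simp only [LinearMap.add_apply, LinearMap.sum_apply, Module.End.mul_apply, sl_sy,
    Module.End.one_apply]
  by_cases hx : x ∈ s
  · rw [pr_sy_mem hx, zero_add, Finset.sum_eq_single (g x)]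
    · simp only [hx, if_true]
      rw [up_sy (by simp), Finset.insert_erase hx, Function.update_eq_self]
    · intro h _ hh
      simp [hx, hh.symm]
    · simp
  · simp [hx, pr_sy hx]

/-- The relation operator `λ_{𝐳(x)} = p(x; Fr_x⁻¹) - N_{𝐳(x)}`, extended by zero to the symbols
whose support contains `x`. -/
def Lam (p : X → Polynomial T) (Fr : X → Grp G) (x : X) : Module.End T (A T G Set.univ) :=
  act T G (evalFrob Fr x (p x)) * pr T G x - nup T G x

variable (p : X → Polynomial T) (Fr : X → Grp G)

theorem Lam_apply (x : X) (a) :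
    Lam p Fr x a = act T G (evalFrob Fr x (p x)) (pr T G x a) - nup T G x a := by
  simp [Lam]

theorem Lam_sy {x : X} {s : Finset X} (hx : x ∉ s) (g : Grp G) :
    Lam p Fr x (sy T G s g) = act T G (evalFrob Fr x (p x)) (sy T G s g) -
      act T G (normElt T G x) (sy T G (insert x s) g) := by
  rw [Lam_apply, pr_sy hx, nup_sy hx]

theorem Lam_act (x : X) (f : MonoidAlgebra T (Grp G)) (a) :
    Lam p Fr x (act T G f a) = act T G f (Lam p Fr x a) := by
  rw [Lam_apply, Lam_apply, pr_act, nup_act, act_comm, map_sub]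

theorem pr_Lam (x : X) (a) :
    pr T G x (Lam p Fr x a) = act T G (evalFrob Fr x (p x)) (pr T G x a) := by
  rw [Lam_apply, map_sub, pr_act, pr_nup, pr_pr, sub_zero]

theorem nup_Lam_comm {x y : X} (hxy : x ≠ y) (a) :
    nup T G x (Lam p Fr y a) = Lam p Fr y (nup T G x a) := by
  rw [Lam_apply, Lam_apply, map_sub, nup_act, nup_nup_comm hxy, pr_nup_comm hxy.symm]

theorem res_Lam_comm {x y : X} (hxy : x ≠ y) (a) :
    res T G x (Lam p Fr y a) = Lam p Fr y (res T G x a) := by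
  rw [Lam_apply, Lam_apply, map_sub, res_act, res_nup_comm hxy, res_pr_comm hxy]

/-- The element `σ_{𝐳(x)} - 1` of `T[G_𝐳]`. -/
abbrev sgElt (σ : ∀ x, G x) (x : X) : MonoidAlgebra T (Grp G) :=
  MonoidAlgebra.of T (Grp G) (Pi.mulSingle x (σ x)) - 1

theorem act_sgElt (σ : ∀ x, G x) (x : X) (a) :
    act T G (sgElt σ x) a = rho T G (Pi.mulSingle x (σ x)) a - a := by
  simp [act, sgElt]

/-- The image of `[g z'] ↦ N_{𝐳(x)} [g 𝐳(x) z']` is fixed by `G_{𝐳(x)}`. -/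
theorem rho_nup (x : X) (h : G x) (a) :
    rho T G (Pi.mulSingle x h) (nup T G x a) = nup T G x a := by
  rw [← act_single, ← nup_act, act_single]
  refine hom_congr (f := nup T G x * rho T G (Pi.mulSingle x h)) (f' := nup T G x)
    (fun s g => ?_) a
  simp only [Module.End.mul_apply, rho_sy]
  by_cases hx : x ∈ s
  · rw [nup_sy_mem hx, nup_sy_mem hx]
  · congr 1
    refine sy_congr _ fun y hy => ?_
    have : y ≠ x := fun h => hx (h ▸ hy)
    simp [this]

theorem sgElt_nup (σ : ∀ x, G x) (x : X) (a) : act T G (sgElt σ x) (nup T G x a) = 0 := by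
  rw [act_sgElt, rho_nup, sub_self]

theorem normElt_mul_sgElt (σ : ∀ x, G x) (x : X) :
    normElt T G x * sgElt σ x = 0 := by
  rw [sgElt, mul_sub, mul_one, sub_eq_zero, normElt, Finset.sum_mul]
  refine Eq.trans ?_ (Equiv.sum_comp (Equiv.mulRight (σ x)) _)
  simp [grpElt, MonoidAlgebra.single_mul_single, Pi.mulSingle_mul]

end Operators

section Relations

variable {T : Type*} [CommRing T] {X : Type*} {G : X → Type*} [∀ x, CommGroup (G x)]

/-! ### Relation submodules between two levels -/

variable (T G) in
/-- The submodule `I 𝒜_𝐳`. -/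
abbrev idlTop (I : Ideal T) : Submodule T (A T G Set.univ) := I • ⊤

theorem rho_mul (g h : Grp G) (a) : rho T G (g * h) a = rho T G g (rho T G h a) := by
  rw [rho, map_mul, Module.End.mul_apply]

theorem map_idlTop {I : Ideal T} (L : Module.End T (A T G Set.univ)) {a} (ha : a ∈ idlTop T G I) :
    L a ∈ idlTop T G I := by
  have h := Submodule.mem_map_of_mem (f := L) ha
  rw [Submodule.map_smul''] at h
  exact Submodule.smul_mono le_rfl le_top h

theorem mem_of_sub_mem {M : Type*} [AddCommGroup M] [Module T M] {N : Submodule T M} {a b : M}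
    (h : a - b ∈ N) (hb : b ∈ N) : a ∈ N := by
  simpa using N.add_mem h hb

theorem mem_of_sub_mem' {M : Type*} [AddCommGroup M] [Module T M] {N : Submodule T M} {a b : M}
    (h : a - b ∈ N) (ha : a ∈ N) : b ∈ N := by
  simpa using N.sub_mem ha h

variable [DecidableEq X]

theorem act_mem (N : Submodule T (A T G Set.univ)) (h : ∀ g, ∀ a ∈ N, rho T G g a ∈ N)
    (f : MonoidAlgebra T (Grp G)) {a} (ha : a ∈ N) : act T G f a ∈ N := by
  induction f using MonoidAlgebra.induction_on with
  | of g => rw [act_single]; exact h g a ha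
  | add f f' h h' => simpa only [act, map_add, LinearMap.add_apply] using N.add_mem h h'
  | smul t f h => simpa only [act, map_smul, LinearMap.smul_apply] using N.smul_mem t h

variable (T G) in
/-- The submodule of `𝒜_𝐳` generated, modulo `I`, by the symbols `[g z']` whose support `s`
satisfies `Y ⊆ s ⊆ S ∪ Y`. -/
def win (I : Ideal T) (S Y : Finset X) : Submodule T (A T G Set.univ) :=
  Submodule.span T {a | ∃ s g, Y ⊆ s ∧ s ⊆ S ∪ Y ∧ a = sy T G s g} ⊔ idlTop T G I

theorem idlTop_le_win {I : Ideal T} {S Y : Finset X} : idlTop T G I ≤ win T G I S Y := le_sup_right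

theorem sy_mem_win {I : Ideal T} {S Y s : Finset X} {g : Grp G} (h : Y ⊆ s) (h' : s ⊆ S ∪ Y) :
    sy T G s g ∈ win T G I S Y :=
  Submodule.mem_sup_left (Submodule.subset_span ⟨s, g, h, h', rfl⟩)

/-- To map `win T G I S Y` into a submodule containing `I 𝒜_𝐳`, it suffices to look at symbols. -/
theorem map_win {I : Ideal T} {S Y : Finset X} {N : Submodule T (A T G Set.univ)}
    (hN : idlTop T G I ≤ N) (L : Module.End T (A T G Set.univ))
    (h : ∀ s g, Y ⊆ s → s ⊆ S ∪ Y → L (sy T G s g) ∈ N) {a} (ha : a ∈ win T G I S Y) :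
    L a ∈ N := by
  suffices win T G I S Y ≤ N.comap L from this ha
  refine sup_le (Submodule.span_le.2 ?_) fun a ha => hN (map_idlTop L ha)
  rintro _ ⟨s, g, hs, hs', rfl⟩
  exact h s g hs hs'

variable [∀ x, Fintype (G x)]

/-- The submodule of `win T G I S Y` generated, modulo `I`, by the distribution relations at the
primes of `S` and by the elements `N_{𝐳(x)} [g z']` for `x ∈ Z`.  It presents a subquotient of
`𝒰_𝐳 / I 𝒰_𝐳`. -/
def rel (I : Ideal T) (p : X → Polynomial T) (Fr : X → Grp G) (S Y Z : Finset X) :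
    Submodule T (A T G Set.univ) :=
  Submodule.span T
    ({a | ∃ y s g, y ∈ S ∧ y ∉ s ∧ Y ⊆ s ∧ s ⊆ S ∪ Y ∧ a = Lam p Fr y (sy T G s g)} ∪
      {a | ∃ z s g, z ∈ Z ∧ Y ⊆ s ∧ s ⊆ S ∪ Y ∧ a = act T G (normElt T G z) (sy T G s g)}) ⊔
    idlTop T G I

variable {I : Ideal T} {p : X → Polynomial T} {Fr : X → Grp G} {S Y Z : Finset X}

theorem idlTop_le_rel : idlTop T G I ≤ rel I p Fr S Y Z := le_sup_right

theorem Lam_sy_mem_rel {y : X} {s : Finset X} {g : Grp G} (hy : y ∈ S) (hys : y ∉ s) (h : Y ⊆ s)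
    (h' : s ⊆ S ∪ Y) : Lam p Fr y (sy T G s g) ∈ rel I p Fr S Y Z :=
  Submodule.mem_sup_left (Submodule.subset_span (Or.inl ⟨y, s, g, hy, hys, h, h', rfl⟩))

theorem norm_sy_mem_rel {z : X} {s : Finset X} {g : Grp G} (hz : z ∈ Z) (h : Y ⊆ s)
    (h' : s ⊆ S ∪ Y) : act T G (normElt T G z) (sy T G s g) ∈ rel I p Fr S Y Z :=
  Submodule.mem_sup_left (Submodule.subset_span (Or.inr ⟨z, s, g, hz, h, h', rfl⟩))

theorem map_rel {N : Submodule T (A T G Set.univ)}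
    (hN : idlTop T G I ≤ N) (L : Module.End T (A T G Set.univ))
    (h : ∀ y s g, y ∈ S → y ∉ s → Y ⊆ s → s ⊆ S ∪ Y → L (Lam p Fr y (sy T G s g)) ∈ N)
    (h' : ∀ z s g, z ∈ Z → Y ⊆ s → s ⊆ S ∪ Y → L (act T G (normElt T G z) (sy T G s g)) ∈ N)
    {a} (ha : a ∈ rel I p Fr S Y Z) : L a ∈ N := by
  suffices rel I p Fr S Y Z ≤ N.comap L from this ha
  refine sup_le (Submodule.span_le.2 (Set.union_subset ?_ ?_)) fun a ha => hN (map_idlTop L ha)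
  · rintro _ ⟨y, s, g, hy, hys, hs, hs', rfl⟩
    exact h y s g hy hys hs hs'
  · rintro _ ⟨z, s, g, hz, hs, hs', rfl⟩
    exact h' z s g hz hs hs'

theorem act_mem_win (f : MonoidAlgebra T (Grp G)) {a} (ha : a ∈ win T G I S Y) :
    act T G f a ∈ win T G I S Y := by
  refine act_mem _ (fun g a ha => map_win idlTop_le_win _ (fun s h hs hs' => ?_) ha) f ha
  rw [rho_sy]
  exact sy_mem_win hs hs'

theorem act_mem_rel (f : MonoidAlgebra T (Grp G)) {a} (ha : a ∈ rel I p Fr S Y Z) :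
    act T G f a ∈ rel I p Fr S Y Z := by
  refine act_mem _ (fun g a ha => map_rel idlTop_le_rel _ (fun y s h hy hys hs hs' => ?_)
    (fun z s h hz hs hs' => ?_) ha) f ha
  · rw [← act_single, ← Lam_act, act_single, rho_sy]
    exact Lam_sy_mem_rel hy hys hs hs'
  · rw [← act_single, act_comm, act_single, rho_sy]
    exact norm_sy_mem_rel hz hs hs'

theorem rho_mem_rel (g : Grp G) {a} (ha : a ∈ rel I p Fr S Y Z) :
    rho T G g a ∈ rel I p Fr S Y Z := by
  rw [← act_single]
  exact act_mem_rel _ ha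

theorem win_mono {S' Y' : Finset X} (hY : Y' ⊆ Y) (hS : S ∪ Y ⊆ S' ∪ Y') :
    win T G I S Y ≤ win T G I S' Y' := fun _ ha =>
  map_win idlTop_le_win 1 (fun _ _ hs hs' => sy_mem_win (hY.trans hs) (hs'.trans hS)) ha

theorem rel_mono {S' Y' Z' : Finset X} (hS' : S ⊆ S') (hY : Y' ⊆ Y) (hS : S ∪ Y ⊆ S' ∪ Y')
    (hZ : Z ⊆ Z') : rel I p Fr S Y Z ≤ rel I p Fr S' Y' Z' := fun _ ha =>
  map_rel idlTop_le_rel 1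
    (fun _ _ _ hy hys hs hs' => Lam_sy_mem_rel (hS' hy) hys (hY.trans hs) (hs'.trans hS))
    (fun _ _ _ hz hs hs' => norm_sy_mem_rel (hZ hz) (hY.trans hs) (hs'.trans hS)) ha

theorem rel_le_win : rel I p Fr S Y Z ≤ win T G I S Y := fun _ ha => by
  refine map_rel idlTop_le_win 1 (fun y s g hy hys hs hs' => ?_) (fun z s g hz hs hs' => ?_) ha
  · rw [Module.End.one_apply, Lam_sy _ _ hys]
    refine sub_mem (act_mem_win _ (sy_mem_win hs hs')) (act_mem_win _ (sy_mem_win ?_ ?_))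
    · exact hs.trans (Finset.subset_insert _ _)
    · exact Finset.insert_subset (Finset.mem_union_left _ hy) hs'
  · exact act_mem_win _ (sy_mem_win hs hs')

section

variable {x : X}

theorem pr_mem_idlTop (hx : x ∈ Y) {a} (ha : a ∈ win T G I S Y) : pr T G x a ∈ idlTop T G I := by
  refine map_win le_rfl _ (fun s g hs _ => ?_) ha
  rw [pr_sy_mem (hs hx)]
  exact zero_mem _

theorem sub_pr_mem_idlTop (hS : x ∉ S) (hY : x ∉ Y) {a} (ha : a ∈ win T G I S Y) :
    a - pr T G x a ∈ idlTop T G I := by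
  refine map_win le_rfl (1 - pr T G x) (fun s g _ hs => ?_) ha
  have : x ∉ s := fun h => by simpa [hS, hY] using hs h
  simp [pr_sy this]

theorem pr_mem_win {a} (ha : a ∈ win T G I (insert x S) Y) :
    pr T G x a ∈ win T G I S Y := by
  refine map_win idlTop_le_win _ (fun s g hs hs' => ?_) ha
  by_cases hx : x ∈ s
  · rw [pr_sy_mem hx]; exact zero_mem _
  · rw [pr_sy hx]
    refine sy_mem_win hs fun y hy => ?_
    have := hs' hy
    rw [Finset.insert_union, Finset.mem_insert] at this
    exact this.resolve_left fun h => hx (h ▸ hy)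

theorem sub_pr_mem_win {a} (ha : a ∈ win T G I (insert x S) Y) :
    a - pr T G x a ∈ win T G I S (insert x Y) := by
  refine map_win idlTop_le_win (1 - pr T G x) (fun s g hs hs' => ?_) ha
  by_cases hx : x ∈ s
  · simp only [LinearMap.sub_apply, Module.End.one_apply, pr_sy_mem hx, sub_zero]
    refine sy_mem_win (Finset.insert_subset hx hs) ?_
    rwa [Finset.union_insert, ← Finset.insert_union]
  · simp [pr_sy hx]

theorem up_mem_win (h : G x) {a} (ha : a ∈ win T G I S Y) :
    up T x h a ∈ win T G I S (insert x Y) := by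
  refine map_win idlTop_le_win _ (fun s g hs hs' => ?_) ha
  by_cases hx : x ∈ s
  · rw [up_sy_mem hx]; exact zero_mem _
  · rw [up_sy hx]
    refine sy_mem_win (Finset.insert_subset_insert _ hs) ?_
    rw [Finset.union_insert]
    exact Finset.insert_subset_insert _ hs'

theorem nup_mem_win {a} (ha : a ∈ win T G I S Y) : nup T G x a ∈ win T G I S (insert x Y) := by
  rw [nup_apply]
  exact sum_mem fun h _ => up_mem_win h ha

theorem erase_window (hY : x ∉ Y) {s : Finset X} (hs : insert x Y ⊆ s)
    (hs' : s ⊆ S ∪ insert x Y) : Y ⊆ s.erase x ∧ s.erase x ⊆ S ∪ Y := by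
  refine ⟨Finset.subset_erase.2 ⟨(Finset.subset_insert _ _).trans hs, hY⟩, fun y hy => ?_⟩
  have h1 := hs' (Finset.mem_of_mem_erase hy)
  have h2 := Finset.ne_of_mem_erase hy
  simpa [h2] using h1

theorem insert_window {s : Finset X} (hs : Y ⊆ s) (hs' : s ⊆ S ∪ Y) :
    insert x Y ⊆ insert x s ∧ insert x s ⊆ S ∪ insert x Y := by
  rw [Finset.union_insert]
  exact ⟨Finset.insert_subset_insert _ hs, Finset.insert_subset_insert _ hs'⟩

theorem notMem_window (hS : x ∉ S) (hY : x ∉ Y) {s : Finset X} (hs' : s ⊆ S ∪ Y) : x ∉ s :=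
  fun h => by simpa [hS, hY] using hs' h

theorem sl_mem_win (hY : x ∉ Y) (h : G x) {a} (ha : a ∈ win T G I S (insert x Y)) :
    sl T x h a ∈ win T G I S Y := by
  classical
  refine map_win idlTop_le_win _ (fun s g hs hs' => ?_) ha
  rw [sl_sy]
  split_ifs
  · exact sy_mem_win (erase_window hY hs hs').1 (erase_window hY hs hs').2
  · exact zero_mem _
  · exact zero_mem _

theorem res_mem_win (hY : x ∉ Y) {a} (ha : a ∈ win T G I S (insert x Y)) :
    res T G x a ∈ win T G I S Y := by
  refine map_win idlTop_le_win _ (fun s g hs hs' => ?_) ha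
  rw [res_sy]
  exact sy_mem_win (erase_window hY hs hs').1 (erase_window hY hs hs').2

theorem nup_mem_rel (hS : x ∉ S) (hY : x ∉ Y) {a} (ha : a ∈ rel I p Fr S Y Z) :
    nup T G x a ∈ rel I p Fr S (insert x Y) Z := by
  refine map_rel idlTop_le_rel _ (fun y s g hy hys hs hs' => ?_) (fun z s g hz hs hs' => ?_) ha
  · have hxy : x ≠ y := fun h => hS (h ▸ hy)
    rw [nup_Lam_comm _ _ hxy, nup_sy (notMem_window hS hY hs'), Lam_act]
    exact act_mem_rel _ (Lam_sy_mem_rel hy (by simp [hys, hxy.symm]) (insert_window hs hs').1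
      (insert_window hs hs').2)
  · rw [nup_act, nup_sy (notMem_window hS hY hs'), act_comm]
    exact act_mem_rel _ (norm_sy_mem_rel hz (insert_window hs hs').1 (insert_window hs hs').2)

theorem Lam_mem_rel (hS : x ∉ S) (hY : x ∉ Y) {a} (ha : a ∈ win T G I S Y) :
    Lam p Fr x a ∈ rel I p Fr (insert x S) Y Z := by
  refine map_win idlTop_le_rel _ (fun s g hs hs' => ?_) ha
  exact Lam_sy_mem_rel (Finset.mem_insert_self _ _) (notMem_window hS hY hs') hs
    (hs'.trans (Finset.union_subset_union_left (Finset.subset_insert _ _)))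

theorem rel_le_rel_insert : rel I p Fr S Y Z ≤ rel I p Fr (insert x S) Y Z :=
  rel_mono (Finset.subset_insert _ _) subset_rfl
    (Finset.union_subset_union_left (Finset.subset_insert _ _)) subset_rfl

theorem rel_insert_le_rel_insert : rel I p Fr S (insert x Y) Z ≤ rel I p Fr (insert x S) Y Z :=
  rel_mono (Finset.subset_insert _ _) (Finset.subset_insert _ _)
    (by rw [Finset.union_insert, Finset.insert_union]) subset_rfl

theorem exists_of_mem_rel_insert (hY : x ∉ Y) {a}
    (ha : a ∈ rel I p Fr (insert x S) Y Z) :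
    ∃ d₀ ∈ rel I p Fr S Y Z, ∃ d₁ ∈ rel I p Fr S (insert x Y) Z, ∃ c ∈ win T G I S Y,
      a = d₀ + d₁ + Lam p Fr x c := by
  have key : ∀ s : Finset X, Y ⊆ s → s ⊆ insert x S ∪ Y →
      (x ∉ s → s ⊆ S ∪ Y) ∧ (x ∈ s → insert x Y ⊆ s ∧ s ⊆ S ∪ insert x Y) := by
    intro s hs hs'
    rw [Finset.insert_union] at hs'
    refine ⟨fun hx y hy => (Finset.mem_insert.1 (hs' hy)).resolve_left fun h => hx (h ▸ hy),
      fun hx => ⟨Finset.insert_subset hx hs, ?_⟩⟩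
    rwa [Finset.union_insert]
  have h : a ∈ (rel I p Fr S Y Z ⊔ rel I p Fr S (insert x Y) Z) ⊔
      (win T G I S Y).map (Lam p Fr x) := by
    refine map_rel (idlTop_le_rel.trans (le_sup_left.trans le_sup_left)) 1
      (fun y s g hy hys hs hs' => ?_) (fun z s g hz hs hs' => ?_) ha
    · rw [Module.End.one_apply]
      obtain ⟨k1, k2⟩ := key s hs hs'
      rcases Finset.mem_insert.1 hy with rfl | hy
      · exact Submodule.mem_sup_right (Submodule.mem_map_of_mem (sy_mem_win hs (k1 hys)))
      · refine Submodule.mem_sup_left ?_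
        by_cases hx : x ∈ s
        · exact Submodule.mem_sup_right (Lam_sy_mem_rel hy hys (k2 hx).1 (k2 hx).2)
        · exact Submodule.mem_sup_left (Lam_sy_mem_rel hy hys hs (k1 hx))
    · rw [Module.End.one_apply]
      obtain ⟨k1, k2⟩ := key s hs hs'
      refine Submodule.mem_sup_left ?_
      by_cases hx : x ∈ s
      · exact Submodule.mem_sup_right (norm_sy_mem_rel hz (k2 hx).1 (k2 hx).2)
      · exact Submodule.mem_sup_left (norm_sy_mem_rel hz hs (k1 hx))
  obtain ⟨d, hd, _, ⟨c, hc, rfl⟩, rfl⟩ := Submodule.mem_sup.1 h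
  obtain ⟨d₀, h₀, d₁, h₁, rfl⟩ := Submodule.mem_sup.1 hd
  exact ⟨d₀, h₀, d₁, h₁, c, hc, rfl⟩

/-- The relations after adjoining the prime `x` to `S`, in terms of the part of an element that
involves `x` and the part that does not: the two parts are relations up to
`-N_{𝐳(x)} c` and `p(x; Fr_x⁻¹) c` for a common element `c`. -/
theorem mem_rel_insert_iff (hS : x ∉ S) (hY : x ∉ Y) {a} :
    a ∈ rel I p Fr (insert x S) Y Z ↔ ∃ c ∈ win T G I S Y,
      (a - pr T G x a) + nup T G x c ∈ rel I p Fr S (insert x Y) Z ∧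
      pr T G x a - act T G (evalFrob Fr x (p x)) c ∈ rel I p Fr S Y Z := by
  constructor
  · intro ha
    obtain ⟨d₀, h₀, d₁, h₁, c, hc, rfl⟩ := exists_of_mem_rel_insert hY ha
    have e₀ := sub_pr_mem_idlTop hS hY (rel_le_win h₀)
    have e₁ := pr_mem_idlTop (Finset.mem_insert_self x Y) (rel_le_win h₁)
    have ec := map_idlTop (act T G (evalFrob Fr x (p x))) (sub_pr_mem_idlTop hS hY hc)
    refine ⟨c, hc, ?_, ?_⟩
    · have : d₀ + d₁ + Lam p Fr x c - pr T G x (d₀ + d₁ + Lam p Fr x c) + nup T G x c =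
          (d₀ - pr T G x d₀) + (d₁ - pr T G x d₁) := by
        rw [map_add, map_add, pr_Lam, Lam_apply]; abel
      rw [this]
      exact add_mem (idlTop_le_rel e₀) (sub_mem h₁ (idlTop_le_rel e₁))
    · have : pr T G x (d₀ + d₁ + Lam p Fr x c) - act T G (evalFrob Fr x (p x)) c =
          d₀ - (d₀ - pr T G x d₀) + pr T G x d₁ -
            act T G (evalFrob Fr x (p x)) (c - pr T G x c) := by
        rw [map_add, map_add, pr_Lam, map_sub (act T G _)]; abel
      rw [this]
      exact sub_mem (add_mem (sub_mem h₀ (idlTop_le_rel e₀)) (idlTop_le_rel e₁))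
        (idlTop_le_rel ec)
  · rintro ⟨c, hc, h₁, h₀⟩
    have ec := map_idlTop (act T G (evalFrob Fr x (p x))) (sub_pr_mem_idlTop hS hY hc)
    have : a = ((a - pr T G x a) + nup T G x c) +
        (pr T G x a - act T G (evalFrob Fr x (p x)) c) + Lam p Fr x c +
          act T G (evalFrob Fr x (p x)) (c - pr T G x c) := by
      rw [Lam_apply, map_sub (act T G _)]; abel
    rw [this]
    exact add_mem (add_mem (add_mem (rel_insert_le_rel_insert h₁) (rel_le_rel_insert h₀))
      (Lam_mem_rel hS hY hc)) (idlTop_le_rel ec)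

/-! ### Exactness at a prime -/

theorem up_mem_rel_empty (hY : x ∉ Y) (hZ : x ∉ Z) (h : G x) {a} (ha : a ∈ rel I p Fr ∅ Y Z) :
    up T x h a ∈ rel I p Fr ∅ (insert x Y) Z := by
  refine map_rel idlTop_le_rel _ (fun y s g hy => absurd hy (Finset.notMem_empty y))
    (fun z s g hz hs hs' => ?_) ha
  rw [act_normElt_comm (ne_of_mem_of_not_mem hz hZ) (up_rho_of_eq_one h),
    up_sy (notMem_window (Finset.notMem_empty x) hY hs')]
  exact norm_sy_mem_rel hz (insert_window hs hs').1 (insert_window hs hs').2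

theorem sl_mem_rel_empty (hY : x ∉ Y) (hZ : x ∉ Z) (h : G x) {a}
    (ha : a ∈ rel I p Fr ∅ (insert x Y) Z) : sl T x h a ∈ rel I p Fr ∅ Y Z := by
  classical
  refine map_rel idlTop_le_rel _ (fun y s g hy => absurd hy (Finset.notMem_empty y))
    (fun z s g hz hs hs' => ?_) ha
  rw [act_normElt_comm (ne_of_mem_of_not_mem hz hZ) (sl_rho_of_eq_one h), sl_sy]
  have hw := erase_window hY hs hs'
  split_ifs
  · exact norm_sy_mem_rel hz hw.1 hw.2
  · rw [map_zero]; exact zero_mem _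
  · rw [map_zero]; exact zero_mem _

/-- Every relation at the level without `x` lifts along the restriction map `res`. -/
theorem exists_res_eq_of_mem_rel (hS : x ∉ S) (hY : x ∉ Y) {a} (ha : a ∈ rel I p Fr S Y Z) :
    ∃ d ∈ rel I p Fr S (insert x Y) Z, a - res T G x d ∈ idlTop T G I := by
  have h : a ∈ (rel I p Fr S (insert x Y) Z).map (res T G x) ⊔ idlTop T G I := by
    refine map_rel le_sup_right 1 (fun y s g hy hys hs hs' => ?_) (fun z s g hz hs hs' => ?_) ha
    all_goals
      refine Submodule.mem_sup_left ?_
      have hx := notMem_window hS hY hs'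
      have e : res T G x (sy T G (insert x s) g) = sy T G s g := by
        rw [res_sy, Finset.erase_insert hx]
      rw [Module.End.one_apply, ← e]
    · have hxy : x ≠ y := fun h => hS (h ▸ hy)
      rw [← res_Lam_comm _ _ hxy]
      exact Submodule.mem_map_of_mem (Lam_sy_mem_rel hy (by simp [hys, hxy.symm])
        (insert_window hs hs').1 (insert_window hs hs').2)
    · rw [← res_act]
      exact Submodule.mem_map_of_mem
        (norm_sy_mem_rel hz (insert_window hs hs').1 (insert_window hs hs').2)
  obtain ⟨_, ⟨d, hd, rfl⟩, j, hj, rfl⟩ := Submodule.mem_sup.1 h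
  exact ⟨d, hd, by simpa using hj⟩

theorem normElt_sub_nup_res_mem {a} (ha : a ∈ win T G I S (insert x Y)) :
    act T G (normElt T G x) a - nup T G x (res T G x a) ∈ idlTop T G I := by
  refine map_win le_rfl (act T G (normElt T G x) - nup T G x * res T G x)
    (fun s g hs hs' => ?_) ha
  have hx : x ∈ s := hs (Finset.mem_insert_self _ _)
  rw [LinearMap.sub_apply, Module.End.mul_apply, res_sy, nup_sy (Finset.notMem_erase x s),
    Finset.insert_erase hx, sub_self]
  exact zero_mem _

variable {σ : ∀ x, G x}

theorem rho_pow_sub_mem_map (N : Submodule T (A T G Set.univ))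
    (hN : ∀ g, ∀ a ∈ N, rho T G g a ∈ N) (k : ℕ) {a} (ha : a ∈ N) :
    rho T G (Pi.mulSingle x (σ x ^ k)) a - a ∈ N.map (act T G (sgElt σ x)) := by
  induction k with
  | zero => simp
  | succ k ih =>
    have : rho T G (Pi.mulSingle x (σ x ^ (k + 1))) a - a =
        act T G (sgElt σ x) (rho T G (Pi.mulSingle x (σ x ^ k)) a) +
          (rho T G (Pi.mulSingle x (σ x ^ k)) a - a) := by
      rw [act_sgElt, pow_succ', Pi.mulSingle_mul, rho_mul]
      abel
    rw [this]
    exact add_mem (Submodule.mem_map_of_mem (hN _ _ ha)) ih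

theorem exists_pow_eq_of_mem_zpowers (hσ : ∀ x, ∀ g : G x, g ∈ Subgroup.zpowers (σ x)) (g : G x) :
    ∃ k : ℕ, σ x ^ k = g :=
  Submonoid.mem_powers_iff _ _ |>.1 ((mem_powers_iff_mem_zpowers).2 (hσ x g))

/-- The kernel of the restriction map `res` at `x` is the image of `σ_{𝐳(x)} - 1`. -/
theorem exists_sub_up_res_mem (hσ : ∀ x, ∀ g : G x, g ∈ Subgroup.zpowers (σ x)) {a}
    (ha : a ∈ win T G I S (insert x Y)) :
    ∃ b ∈ win T G I S (insert x Y),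
      a - up T x 1 (res T G x a) - act T G (sgElt σ x) b ∈ idlTop T G I := by
  have h : (1 - up T x 1 * res T G x : Module.End T (A T G Set.univ)) a ∈
      (win T G I S (insert x Y)).map (act T G (sgElt σ x)) ⊔ idlTop T G I := by
    refine map_win le_sup_right _ (fun s g hs hs' => Submodule.mem_sup_left ?_) ha
    have hx : x ∈ s := hs (Finset.mem_insert_self _ _)
    obtain ⟨k, hk⟩ := exists_pow_eq_of_mem_zpowers hσ (g x)
    have e : sy T G s g = rho T G (Pi.mulSingle x (σ x ^ k)) (sy T G s (Function.update g x 1)) := by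
      rw [rho_sy]
      refine sy_congr _ fun y _ => ?_
      by_cases hy : y = x
      · subst hy; simp [hk]
      · simp [hy]
    rw [LinearMap.sub_apply, Module.End.one_apply, Module.End.mul_apply, res_sy,
      up_sy (Finset.notMem_erase x s), Finset.insert_erase hx]
    nth_rewrite 1 [e]
    refine rho_pow_sub_mem_map _ (fun g a ha => ?_) k (sy_mem_win hs hs')
    rw [← act_single]
    exact act_mem_win _ ha
  obtain ⟨_, ⟨b, hb, rfl⟩, j, hj, e⟩ := Submodule.mem_sup.1 h
  refine ⟨b, hb, ?_⟩
  have : a - up T x 1 (res T G x a) - act T G (sgElt σ x) b = j := by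
    rw [LinearMap.sub_apply, Module.End.one_apply, Module.End.mul_apply] at e
    rw [← e]; abel
  rwa [this]

/-- If `N_{𝐳(x)}` is injective modulo relations as a map from the level without `x` to the level
with `x`, then the kernel of multiplication by `N_{𝐳(x)}` on the level with `x` is the
image of `σ_{𝐳(x)} - 1`. -/
theorem exists_sgElt_of_normElt_mem (hσ : ∀ x, ∀ g : G x, g ∈ Subgroup.zpowers (σ x))
    (hS : x ∉ S) (hY : x ∉ Y)
    (hinj : ∀ a ∈ win T G I S Y, nup T G x a ∈ rel I p Fr S (insert x Y) Z → a ∈ rel I p Fr S Y Z)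
    {b} (hb : b ∈ win T G I S (insert x Y))
    (h : act T G (normElt T G x) b ∈ rel I p Fr S (insert x Y) Z) :
    ∃ b' ∈ win T G I S (insert x Y),
      b - act T G (sgElt σ x) b' ∈ rel I p Fr S (insert x Y) Z := by
  have h1 := hinj _ (res_mem_win hY hb)
    (mem_of_sub_mem' (idlTop_le_rel (normElt_sub_nup_res_mem hb)) h)
  obtain ⟨d, hd, hd'⟩ := exists_res_eq_of_mem_rel hS hY h1
  obtain ⟨b', hb', e⟩ := exists_sub_up_res_mem hσ (sub_mem hb (rel_le_win hd))
  refine ⟨b', hb', ?_⟩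
  have e' := map_idlTop (up T x 1) hd'
  have : b - act T G (sgElt σ x) b' = d +
      (b - d - up T x 1 (res T G x (b - d)) - act T G (sgElt σ x) b') +
        up T x 1 (res T G x b - res T G x d) := by
    rw [map_sub (res T G x)]; abel
  rw [this]
  exact add_mem (add_mem hd (idlTop_le_rel e)) (idlTop_le_rel e')

/-- `σ_{𝐳(x)}` shifts the slices at `x`. -/
theorem sl_sgElt (k : ℕ) (a) :
    sl T x (σ x ^ (k + 1)) (act T G (sgElt σ x) a) =
      sl T x (σ x ^ k) a - sl T x (σ x ^ (k + 1)) a := by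
  rw [act_sgElt, map_sub]
  congr 1
  refine hom_congr (f := sl T x (σ x ^ (k + 1)) * rho T G (Pi.mulSingle x (σ x)))
    (f' := sl T x (σ x ^ k)) (fun s g => ?_) a
  classical
  rw [Module.End.mul_apply, rho_sy, sl_sy, sl_sy, Pi.mul_apply, Pi.mulSingle_eq_same, pow_succ']
  by_cases h : g x = σ x ^ k
  · by_cases hx : x ∈ s
    · simp only [hx, h, if_true]
      refine sy_congr _ fun y hy => ?_
      simp [Finset.ne_of_mem_erase hy]
    · simp [hx]
  · simp [h]

/-- Tate acyclicity of the relation quotients at a prime `x` outside `S`: the map `N_{𝐳(x)}` from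
the level without `x` to the level with `x` is injective modulo relations, and its image is the
kernel of `σ_{𝐳(x)} - 1`. -/
theorem nup_injective_and_exact (hσ : ∀ x, ∀ g : G x, g ∈ Subgroup.zpowers (σ x)) (S : Finset X) :
    ∀ (Y Z : Finset X) (x : X), Disjoint S Y → x ∉ S → x ∉ Y → Z ⊆ Y →
      (∀ a ∈ win T G I S Y, nup T G x a ∈ rel I p Fr S (insert x Y) Z → a ∈ rel I p Fr S Y Z) ∧
      (∀ c ∈ win T G I S (insert x Y),
        act T G (sgElt σ x) c ∈ rel I p Fr S (insert x Y) Z →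
          ∃ e ∈ win T G I S Y, c - nup T G x e ∈ rel I p Fr S (insert x Y) Z) := by
  induction S using Finset.induction_on with
  | empty =>
    intro Y Z x _ hS hY hZY
    have hZ : x ∉ Z := fun h => hY (hZY h)
    constructor
    · intro a ha h
      have h1 := sl_mem_rel_empty hY hZ 1 h
      rw [sl_nup] at h1
      exact mem_of_sub_mem (idlTop_le_rel (sub_pr_mem_idlTop hS hY ha)) h1
    · intro c hc h
      -- All slices of `c` at `x` agree modulo relations, because `c` is fixed by `σ_{𝐳(x)}`.
      refine ⟨sl T x 1 c, sl_mem_win hY 1 hc, ?_⟩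
      have h1 : ∀ k : ℕ, sl T x (σ x ^ k) c - sl T x 1 c ∈ rel I p Fr ∅ Y Z := by
        intro k
        induction k with
        | zero => simp
        | succ k ih =>
          have h2 := sl_mem_rel_empty hY hZ (σ x ^ (k + 1)) h
          rw [sl_sgElt] at h2
          simpa using sub_mem ih h2
      have : c - nup T G x (sl T x 1 c) =
          pr T G x c + ∑ g : G x, up T x g (sl T x g c - sl T x 1 c) := by
        nth_rewrite 1 [← pr_add_sum_up_sl x c]
        rw [nup_apply]
        simp only [map_sub, Finset.sum_sub_distrib]
        abel
      rw [this]
      refine add_mem (idlTop_le_rel (pr_mem_idlTop (Finset.mem_insert_self _ _) hc))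
        (sum_mem fun g _ => up_mem_rel_empty hY hZ g ?_)
      obtain ⟨k, rfl⟩ := exists_pow_eq_of_mem_zpowers hσ g
      exact h1 k
  | insert z S hzS ih =>
    intro Y Z x hSY hxS hxY hZY
    rw [Finset.disjoint_insert_left] at hSY
    obtain ⟨hzY, hSY⟩ := hSY
    rw [Finset.mem_insert, not_or] at hxS
    obtain ⟨hxz, hxS⟩ := hxS
    have hxz : x ≠ z := hxz
    have hzx : z ∉ insert x Y := by simp [hzY, hxz.symm]
    have hxz' : x ∉ insert z Y := by simp [hxY, hxz]
    have hSx : Disjoint S (insert x Y) := Finset.disjoint_insert_right.2 ⟨hxS, hSY⟩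
    have hSz : Disjoint S (insert z Y) := Finset.disjoint_insert_right.2 ⟨hzS, hSY⟩
    obtain ⟨inj₀, ex₀⟩ := ih Y Z x hSY hxS hxY hZY
    obtain ⟨inj₁, ex₁⟩ := ih (insert z Y) Z x hSz hxS hxz' (hZY.trans (Finset.subset_insert _ _))
    obtain ⟨injz, -⟩ := ih (insert x Y) Z z hSx hzS hzx (hZY.trans (Finset.subset_insert _ _))
    rw [Finset.insert_comm x z Y] at inj₁ ex₁
    constructor
    · intro a ha h
      obtain ⟨c, hc, h1, h0⟩ := (mem_rel_insert_iff hzS hzx).1 h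
      rw [pr_nup_comm hxz.symm] at h1 h0
      rw [← map_sub] at h1
      -- `σ_{𝐳(x)} - 1` kills the first summand of `h1`, hence kills `c` modulo relations.
      have h2 := act_mem_rel (sgElt σ x) h1
      rw [map_add, sgElt_nup, zero_add, ← nup_act] at h2
      obtain ⟨e, he, hce⟩ := ex₀ c hc (injz _ (act_mem_win _ hc) h2)
      refine (mem_rel_insert_iff hzS hzY).2 ⟨e, he, inj₁ _ ?_ ?_, inj₀ _ ?_ ?_⟩
      · exact add_mem (sub_pr_mem_win ha) (nup_mem_win he)
      · have : nup T G x (a - pr T G z a + nup T G z e) =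
            (nup T G x (a - pr T G z a) + nup T G z c) - nup T G z (c - nup T G x e) := by
          rw [map_add, nup_nup_comm hxz, map_sub (nup T G z)]; abel
        rw [this]
        exact sub_mem h1 (nup_mem_rel hzS hzx hce)
      · exact sub_mem (pr_mem_win ha) (act_mem_win _ he)
      · have : nup T G x (pr T G z a - act T G (evalFrob Fr z (p z)) e) =
            (nup T G x (pr T G z a) - act T G (evalFrob Fr z (p z)) c) +
              act T G (evalFrob Fr z (p z)) (c - nup T G x e) := by
          rw [map_sub, nup_act, map_sub (act T G _)]; abel
        rw [this]
        exact add_mem h0 (act_mem_rel _ hce)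
    · intro c hc h
      obtain ⟨b, hb, h1, h0⟩ := (mem_rel_insert_iff hzS hzx).1 h
      rw [pr_act] at h1 h0
      rw [← map_sub] at h1
      -- `N_{𝐳(x)}` kills the first summand of `h1`, hence kills `b` modulo relations.
      have h2 := act_mem_rel (normElt T G x) h1
      rw [map_add, ← act_mul, normElt_mul_sgElt, ← nup_act] at h2
      simp only [act, map_zero, LinearMap.zero_apply, zero_add] at h2
      obtain ⟨b', hb', hbb⟩ := exists_sgElt_of_normElt_mem hσ hxS hxY inj₀ hb
        (injz _ (act_mem_win _ hb) h2)
      have hc0 := pr_mem_win hc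
      have hc1 := sub_pr_mem_win hc
      have h3 : act T G (sgElt σ x) (c - pr T G z c + nup T G z b') ∈
          rel I p Fr S (insert z (insert x Y)) Z := by
        have : act T G (sgElt σ x) (c - pr T G z c + nup T G z b') =
            (act T G (sgElt σ x) (c - pr T G z c) + nup T G z b) -
              nup T G z (b - act T G (sgElt σ x) b') := by
          rw [map_add, ← nup_act, map_sub (nup T G z)]; abel
        rw [this]
        exact sub_mem h1 (nup_mem_rel hzS hzx hbb)
      have h4 : act T G (sgElt σ x) (pr T G z c - act T G (evalFrob Fr z (p z)) b') ∈
          rel I p Fr S (insert x Y) Z := by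
        have : act T G (sgElt σ x) (pr T G z c - act T G (evalFrob Fr z (p z)) b') =
            (act T G (sgElt σ x) (pr T G z c) - act T G (evalFrob Fr z (p z)) b) +
              act T G (evalFrob Fr z (p z)) (b - act T G (sgElt σ x) b') := by
          rw [map_sub, act_comm (sgElt σ x) _ b', map_sub (act T G (evalFrob Fr z (p z)))]; abel
        rw [this]
        exact add_mem h0 (act_mem_rel _ hbb)
      obtain ⟨e₁, he₁, k1⟩ := ex₁ _ (add_mem hc1 (nup_mem_win hb')) h3
      obtain ⟨e₀, he₀, k0⟩ := ex₀ _ (sub_mem hc0 (act_mem_win _ hb')) h4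
      have p1 := map_idlTop (nup T G x) (pr_mem_idlTop (Finset.mem_insert_self z Y) he₁)
      have p0 := map_idlTop (nup T G x) (sub_pr_mem_idlTop hzS hzY he₀)
      refine ⟨e₀ + e₁, add_mem (win_mono subset_rfl
        (Finset.union_subset_union_left (Finset.subset_insert _ _)) he₀)
        (win_mono (Finset.subset_insert _ _)
          (by rw [Finset.union_insert, Finset.insert_union]) he₁),
        (mem_rel_insert_iff hzS hzx).2 ⟨b', hb', ?_, ?_⟩⟩
      · have : c - nup T G x (e₀ + e₁) - pr T G z (c - nup T G x (e₀ + e₁)) + nup T G z b' =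
            (c - pr T G z c + nup T G z b' - nup T G x e₁) - nup T G x (e₀ - pr T G z e₀) +
              nup T G x (pr T G z e₁) := by
          simp only [map_sub, map_add, pr_nup_comm hxz.symm]; abel
        rw [this]
        exact add_mem (sub_mem k1 (idlTop_le_rel p0)) (idlTop_le_rel p1)
      · have : pr T G z (c - nup T G x (e₀ + e₁)) - act T G (evalFrob Fr z (p z)) b' =
            (pr T G z c - act T G (evalFrob Fr z (p z)) b' - nup T G x e₀) +
              nup T G x (e₀ - pr T G z e₀) - nup T G x (pr T G z e₁) := by
          simp only [map_sub, map_add, pr_nup_comm hxz.symm]; abel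
        rw [this]
        exact sub_mem (add_mem k0 (idlTop_le_rel p0)) (idlTop_le_rel p1)

/-- Adjoining a prime to `S` adds no relations among the symbols not involving that prime: the
subquotient of level `S` embeds into the one of level `insert x S`. -/
theorem mem_rel_of_mem_rel_insert (hσ : ∀ x, ∀ g : G x, g ∈ Subgroup.zpowers (σ x))
    (hSY : Disjoint S Y) (hS : x ∉ S) (hY : x ∉ Y) (hZ : Z ⊆ Y) {a} (ha : a ∈ win T G I S Y)
    (h : a ∈ rel I p Fr (insert x S) Y Z) : a ∈ rel I p Fr S Y Z := by
  obtain ⟨c, hc, h1, h0⟩ := (mem_rel_insert_iff hS hY).1 h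
  have ea : a - pr T G x a ∈ rel I p Fr S Y Z := idlTop_le_rel (sub_pr_mem_idlTop hS hY ha)
  have h2 : nup T G x c ∈ rel I p Fr S (insert x Y) Z := by
    simpa using sub_mem h1 (idlTop_le_rel (sub_pr_mem_idlTop hS hY ha))
  have hc' := (nup_injective_and_exact hσ S Y Z x hSY hS hY hZ).1 c hc h2
  exact mem_of_sub_mem ea (mem_of_sub_mem h0 (act_mem_rel _ hc'))

end

end Relations

section Kolyvagin

variable {T : Type*} [CommRing T] {X : Type*} {G : X → Type*} [∀ x, CommGroup (G x)]
  [DecidableEq X] [∀ x, Fintype (G x)]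
  {I : Ideal T} {p : X → Polynomial T} {Fr : X → Grp G} {S Y Z : Finset X}

/-! ### Kolyvagin classes and their invariance -/

variable (T) in
/-- The element `D_w [𝐳(w)]` of `𝒜_𝐳`. -/
def kap (σ : ∀ x, G x) (w : Finset X) : A T G Set.univ :=
  act T G (kolyDProd T σ w) (sy T G w 1)

theorem smul_mem_idlTop {t : T} (ht : t ∈ I) (a) : t • a ∈ idlTop T G I :=
  Submodule.smul_mem_smul ht Submodule.mem_top

theorem kap_empty (σ : ∀ x, G x) : kap T σ (∅ : Finset X) = sy T G ∅ 1 := by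
  simp [kap, kolyDProd, act]

theorem kap_mem_win (σ : ∀ x, G x) {w : Finset X} (h : Y ⊆ w) (h' : w ⊆ S ∪ Y) :
    kap T σ w ∈ win T G I S Y :=
  act_mem_win _ (sy_mem_win h h')

theorem pr_kap {x : X} (σ : ∀ x, G x) {w : Finset X} (hx : x ∉ w) :
    pr T G x (kap T σ w) = kap T σ w := by
  rw [kap, pr_act, pr_sy hx]

theorem pr_kap_mem {x : X} (σ : ∀ x, G x) {w : Finset X} (hx : x ∈ w) :
    pr T G x (kap T σ w) = 0 := by
  rw [kap, pr_act, pr_sy_mem hx, map_zero]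

variable {σ : ∀ x, G x}

theorem sum_univ_eq_sum_range_pow {M : Type*} [AddCommMonoid M]
    (hσ : ∀ x, ∀ g : G x, g ∈ Subgroup.zpowers (σ x)) (x : X) (f : G x → M) :
    ∑ h : G x, f h = ∑ k ∈ Finset.range (Fintype.card (G x)), f (σ x ^ k) := by
  classical
  rw [← IsCyclic.image_range_card (hσ x), Finset.sum_image, Nat.card_eq_fintype_card]
  intro i hi j hj hij
  have hn := orderOf_eq_card_of_forall_mem_zpowers (hσ x)
  exact pow_injOn_Iio_orderOf (by simpa [hn] using hi) (by simpa [hn] using hj) hij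

/-- The derivative relation `(σ_{𝐳(x)} - 1) D_{𝐳(x)} = |G_{𝐳(x)}| - N_{𝐳(x)}`. -/
theorem sgElt_kolyD (hσ : ∀ x, ∀ g : G x, g ∈ Subgroup.zpowers (σ x)) (x : X) (a) :
    act T G (sgElt σ x) (act T G (kolyD T σ x) a) =
      Fintype.card (G x) • a - act T G (normElt T G x) a := by
  set u : ℕ → A T G Set.univ := fun k => rho T G (Pi.mulSingle x (σ x ^ k)) a with hu
  have hu0 : u 0 = a := by simp [hu]
  have hun : u (Fintype.card (G x)) = a := by simp [hu, pow_card_eq_one]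
  have hs : ∀ k, rho T G (Pi.mulSingle x (σ x)) (u k) = u (k + 1) := fun k => by
    rw [hu, ← rho_mul, ← Pi.mulSingle_mul, ← pow_succ']
  have hN : act T G (normElt T G x) a = ∑ k ∈ Finset.range (Fintype.card (G x)), u k := by
    rw [act_normElt, sum_univ_eq_sum_range_pow hσ]
  have hD : act T G (kolyD T σ x) a = ∑ k ∈ Finset.range (Fintype.card (G x)), k • u k := by
    rw [act_kolyD]
  have h1 := Finset.sum_range_sub u (Fintype.card (G x))
  have h2 := Finset.sum_range_sub (fun k => k • u k) (Fintype.card (G x))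
  rw [hu0, hun, sub_self, Finset.sum_sub_distrib, sub_eq_zero] at h1
  simp only [hun, zero_smul, sub_zero] at h2
  rw [← h2, hN, ← h1, hD, act_sgElt, map_sum, ← Finset.sum_sub_distrib,
    ← Finset.sum_sub_distrib]
  refine Finset.sum_congr rfl fun k _ => ?_
  rw [map_nsmul, hs, succ_nsmul]
  abel

theorem rho_mul_sub_mem {a} {g h : Grp G} (hg : rho T G g a - a ∈ rel I p Fr S Y Z)
    (hh : rho T G h a - a ∈ rel I p Fr S Y Z) : rho T G (g * h) a - a ∈ rel I p Fr S Y Z := by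
  have : rho T G (g * h) a - a = rho T G g (rho T G h a - a) + (rho T G g a - a) := by
    rw [rho_mul, map_sub]; abel
  rw [this]
  exact add_mem (rho_mem_rel g hh) hg

/-- On elements that are invariant modulo relations, `f(Fr_x⁻¹)` acts as `f(1)`. -/
theorem evalFrob_sub_eval_mem {a} (ha : ∀ g, rho T G g a - a ∈ rel I p Fr S Y Z) (x : X)
    (f : Polynomial T) :
    act T G (evalFrob Fr x f) a - f.eval 1 • a ∈ rel I p Fr S Y Z := by
  induction f using Polynomial.induction_on' with
  | add f f' h h' =>
    have : act T G (evalFrob Fr x (f + f')) a - (f + f').eval 1 • a =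
        (act T G (evalFrob Fr x f) a - f.eval 1 • a) +
          (act T G (evalFrob Fr x f') a - f'.eval 1 • a) := by
      simp only [evalFrob, act, map_add, LinearMap.add_apply, Polynomial.eval_add, add_smul]
      abel
    rw [this]
    exact add_mem h h'
  | monomial n t =>
    have : act T G (evalFrob Fr x (Polynomial.monomial n t)) a =
        t • rho T G ((Fr x)⁻¹ ^ n) a := by
      rw [evalFrob, Polynomial.aeval_monomial, grpElt, ← map_pow, ← Algebra.smul_def, act,
        map_smul, LinearMap.smul_apply, ← act, act_single]
    rw [this, Polynomial.eval_monomial, one_pow, mul_one, ← smul_sub]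
    exact Submodule.smul_mem _ _ (ha _)

/-- The element `D_w [𝐳(w)]` is `G_𝐳`-invariant modulo relations. -/
theorem rho_kap_sub_mem (hσ : ∀ x, ∀ g : G x, g ∈ Subgroup.zpowers (σ x))
    (hI : ∀ x, (Fintype.card (G x) : T) ∈ I) (hp : ∀ x, (p x).eval 1 ∈ I)
    (w : Finset X) (h : Z ⊆ w) (h' : w ⊆ S ∪ Z) (g : Grp G) :
    rho T G g (kap T σ w) - kap T σ w ∈ rel I p Fr S Z Z := by
  induction w using Finset.strongInduction generalizing g with
  | H w ih =>
  -- For `x ∈ S`, the relation at `x` trades `N_{𝐳(x)} [𝐳(w)]` for `p(x; Fr_x⁻¹) [𝐳(w) / 𝐳(x)]`, and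
  -- `p(x; Fr_x⁻¹)` acts as `p(x; 1)` on the invariant element attached to `w / x`.
  have gen : ∀ x ∈ w, act T G (sgElt σ x) (kap T σ w) ∈ rel I p Fr S Z Z := by
    intro x hx
    rw [kap, kolyDProd, ← Finset.mul_prod_erase _ _ hx, act_mul, sgElt_kolyD hσ,
      ← Nat.cast_smul_eq_nsmul T]
    refine sub_mem (idlTop_le_rel (smul_mem_idlTop (hI x) _)) ?_
    rw [act_comm]
    by_cases hxZ : x ∈ Z
    · exact act_mem_rel _ (norm_sy_mem_rel hxZ h h')
    have hxS : x ∈ S := (Finset.mem_union.1 (h' hx)).resolve_right hxZ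
    have hZ : Z ⊆ w.erase x := Finset.subset_erase.2 ⟨h, hxZ⟩
    have hw : w.erase x ⊆ S ∪ Z := (Finset.erase_subset _ _).trans h'
    have e1 := Lam_sy p Fr (Finset.notMem_erase x w) (1 : Grp G)
    rw [Finset.insert_erase hx] at e1
    have e2 : act T G (normElt T G x) (sy T G w 1) =
        act T G (evalFrob Fr x (p x)) (sy T G (w.erase x) 1) -
          Lam p Fr x (sy T G (w.erase x) 1) := by rw [e1]; abel
    rw [e2, map_sub, act_comm]
    refine sub_mem ?_ (act_mem_rel _ (Lam_sy_mem_rel hxS (Finset.notMem_erase x w) hZ hw))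
    exact mem_of_sub_mem
      (evalFrob_sub_eval_mem (fun g => ih _ (Finset.erase_ssubset hx) hZ hw g) x (p x))
      (idlTop_le_rel (smul_mem_idlTop (hp x) _))
  have single : ∀ x ∈ w, ∀ k : ℕ, rho T G (Pi.mulSingle x (σ x ^ k)) (kap T σ w) - kap T σ w ∈
      rel I p Fr S Z Z := by
    intro x hx k
    induction k with
    | zero => simp
    | succ k ihk =>
      rw [pow_succ', Pi.mulSingle_mul]
      refine rho_mul_sub_mem ?_ ihk
      rw [← act_sgElt]
      exact gen x hx
  have prod : ∀ v ⊆ w, rho T G (∏ x ∈ v, Pi.mulSingle x (g x)) (kap T σ w) - kap T σ w ∈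
      rel I p Fr S Z Z := by
    intro v
    induction v using Finset.induction_on with
    | empty => simp
    | insert x v hx ihv =>
      intro hv
      rw [Finset.prod_insert hx]
      refine rho_mul_sub_mem ?_ (ihv ((Finset.subset_insert _ _).trans hv))
      obtain ⟨k, hk⟩ := exists_pow_eq_of_mem_zpowers hσ (g x)
      rw [← hk]
      exact single x (hv (Finset.mem_insert_self _ _)) k
  have : rho T G g (kap T σ w) = rho T G (∏ x ∈ w, Pi.mulSingle x (g x)) (kap T σ w) := by
    rw [kap, ← act_single, ← act_single, act_comm, act_comm (MonoidAlgebra.of _ _ _), act_single,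
      act_single, rho_sy, rho_sy]
    congr 1
    refine sy_congr _ fun y hy => ?_
    rw [Pi.mul_apply, Pi.mul_apply, Finset.prod_apply, Finset.prod_pi_mulSingle, if_pos hy]
  rw [this]
  exact prod w subset_rfl

/-- The components of `D_w [𝐳(w)]` at a prime `x` of `w`. -/
theorem kap_insert {x : X} (hx : x ∉ Z) :
    kap T σ (insert x Z) =
      ∑ k ∈ Finset.range (Fintype.card (G x)), k • up T x (σ x ^ k) (kap T σ Z) := by
  have e : sy T G (insert x Z) 1 = up T x 1 (sy T G Z 1) := by
    rw [up_sy hx]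
    congr 1
    exact (Function.update_eq_self x (1 : Grp G)).symm
  rw [kap, kolyDProd, Finset.prod_insert hx, act_mul, act_kolyD, e]
  refine Finset.sum_congr rfl fun k _ => ?_
  have e2 : rho T G (Pi.mulSingle x (σ x ^ k)) (kap T σ Z) = kap T σ Z := by
    rw [kap, ← act_single, act_comm, act_single, rho_sy]
    congr 1
    refine sy_congr _ fun y hy => ?_
    have : y ≠ x := fun h => hx (h ▸ hy)
    simp [this]
  change k • rho T G _ (act T G (kolyDProd T σ Z) _) = _
  rw [← act_kolyDProd_comm (up_rho_of_eq_one 1) σ hx, ← kap, rho_up, e2, Pi.mulSingle_eq_same,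
    mul_one]

/-! ### Invariants of a tensor product of cyclic group rings modulo norms -/

section

variable {x : X}

theorem nup_mem_rel_insert (hS : x ∉ S) (hY : x ∉ Y) {a} (ha : a ∈ win T G I S Y) :
    nup T G x a ∈ rel I p Fr S (insert x Y) (insert x Z) := by
  refine map_win idlTop_le_rel _ (fun s g hs hs' => ?_) ha
  rw [nup_sy (notMem_window hS hY hs')]
  exact norm_sy_mem_rel (Finset.mem_insert_self _ _) (insert_window hs hs').1
    (insert_window hs hs').2

/-- Killing `N_{𝐳(x)}` amounts to killing the image of `nup T G x`. -/
theorem exists_nup_of_mem_rel_insert (hY : x ∉ Y) {a}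
    (ha : a ∈ rel I p Fr S (insert x Y) (insert x Z)) :
    ∃ d ∈ rel I p Fr S (insert x Y) Z, ∃ e ∈ win T G I S Y, a = d + nup T G x e := by
  have h : a ∈ rel I p Fr S (insert x Y) Z ⊔ (win T G I S Y).map (nup T G x) := by
    refine map_rel (idlTop_le_rel.trans le_sup_left) 1
      (fun y s g hy hys hs hs' => Submodule.mem_sup_left (Lam_sy_mem_rel hy hys hs hs'))
      (fun z s g hz hs hs' => ?_) ha
    rcases Finset.mem_insert.1 hz with rfl | hz
    · have hw := erase_window hY hs hs'
      have e := nup_sy (T := T) (Finset.notMem_erase z s) g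
      rw [Finset.insert_erase (hs (Finset.mem_insert_self _ _))] at e
      rw [Module.End.one_apply, ← e]
      exact Submodule.mem_sup_right (Submodule.mem_map_of_mem (sy_mem_win hw.1 hw.2))
    · exact Submodule.mem_sup_left (norm_sy_mem_rel hz hs hs')
  obtain ⟨d, hd, _, ⟨e, he, rfl⟩, rfl⟩ := Submodule.mem_sup.1 h
  exact ⟨d, hd, e, he, rfl⟩

/-- The difference of two slices at `x` kills `N_{𝐳(x)}`. -/
theorem sl_sub_sl_mem (hZ : x ∉ Z) (h k : G x) {a}
    (ha : a ∈ rel I p Fr ∅ (insert x Z) (insert x Z)) :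
    sl T x h a - sl T x k a ∈ rel I p Fr ∅ Z Z := by
  obtain ⟨d, hd, e, he, rfl⟩ := exists_nup_of_mem_rel_insert hZ ha
  rw [map_add, map_add, sl_nup, sl_nup, add_sub_add_right_eq_sub]
  exact sub_mem (sl_mem_rel_empty hZ hZ h hd) (sl_mem_rel_empty hZ hZ k hd)

theorem act_sgElt_sl {z : X} (hz : z ≠ x) (h : G x) (a) :
    act T G (sgElt σ z) (sl T x h a) = sl T x h (act T G (sgElt σ z) a) := by
  rw [act_sgElt, act_sgElt, map_sub, sl_rho_of_eq_one]
  simp [hz.symm]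

/-- The invariants of `⨂_{z ∈ Z} (T/I)[G_{𝐳(z)}] / N_{𝐳(z)}` are generated by the class of
`D_Z [𝐳(Z)]`. -/
theorem exists_sub_smul_kap_mem (hσ : ∀ x, ∀ g : G x, g ∈ Subgroup.zpowers (σ x))
    (Z : Finset X) : ∀ a ∈ win T G I ∅ Z,
      (∀ z ∈ Z, act T G (sgElt σ z) a ∈ rel I p Fr ∅ Z Z) →
        ∃ c : T, a - c • kap T σ Z ∈ rel I p Fr ∅ Z Z := by
  induction Z using Finset.induction_on with
  | empty =>
    intro a ha _
    have h : a ∈ Submodule.span T {kap T σ (∅ : Finset X)} ⊔ rel I p Fr ∅ ∅ ∅ := by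
      refine map_win (idlTop_le_rel.trans le_sup_right) 1 (fun s g hs hs' => ?_) ha
      obtain rfl : s = ∅ := Finset.subset_empty.1 hs'
      have e : sy T G (∅ : Finset X) g = kap T σ ∅ := by
        rw [kap_empty]
        exact sy_congr _ fun y hy => absurd hy (Finset.notMem_empty y)
      rw [Module.End.one_apply, e]
      exact Submodule.mem_sup_left (Submodule.mem_span_singleton_self _)
    obtain ⟨b, hb, d, hd, rfl⟩ := Submodule.mem_sup.1 h
    obtain ⟨c, rfl⟩ := Submodule.mem_span_singleton.1 hb
    exact ⟨c, by simpa using hd⟩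
  | insert x Z hx ih =>
    intro a ha hinv
    obtain ⟨d, hd, e, he, hde⟩ :=
      exists_nup_of_mem_rel_insert hx (hinv x (Finset.mem_insert_self _ _))
    have e0 := idlTop_le_rel (p := p) (Fr := Fr) (S := ∅) (Y := Z) (Z := Z)
      (sub_pr_mem_idlTop (Finset.notMem_empty x) hx he)
    -- The slices of `a` form an arithmetic progression with difference `-e`.
    have hk : ∀ k : ℕ, sl T x (σ x ^ k) a - sl T x 1 a + k • e ∈ rel I p Fr ∅ Z Z := by
      intro k
      induction k with
      | zero => simp
      | succ k ihk =>
        have h1 := sl_sgElt (σ := σ) (x := x) k a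
        rw [hde, map_add, sl_nup] at h1
        have : sl T x (σ x ^ (k + 1)) a - sl T x 1 a + (k + 1) • e =
            (sl T x (σ x ^ k) a - sl T x 1 a + k • e) -
              (sl T x (σ x ^ k) a - sl T x (σ x ^ (k + 1)) a) + e := by
          rw [succ_nsmul]; abel
        rw [this, ← h1]
        have h2 := sl_mem_rel_empty hx hx (σ x ^ (k + 1)) hd
        have h3 := add_mem (sub_mem ihk h2) e0
        convert h3 using 1
        abel
    have hek : ∀ z ∈ Z, act T G (sgElt σ z) e ∈ rel I p Fr ∅ Z Z := by
      intro z hz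
      have hzx : z ≠ x := ne_of_mem_of_not_mem hz hx
      have h1 := act_mem_rel (sgElt σ z) (hk 1)
      rw [pow_one, one_smul, map_add, map_sub, act_sgElt_sl hzx, act_sgElt_sl hzx] at h1
      exact (add_mem_cancel_left
        (sl_sub_sl_mem hx _ _ (hinv z (Finset.mem_insert_of_mem hz)))).1 h1
    obtain ⟨c, hc⟩ := ih e he hek
    refine ⟨-c, ?_⟩
    have main : a - -c • kap T σ (insert x Z) = pr T G x a + nup T G x (sl T x 1 a) +
        ∑ k ∈ Finset.range (Fintype.card (G x)),
          (up T x (σ x ^ k) (sl T x (σ x ^ k) a - sl T x 1 a + k • e) -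
            k • up T x (σ x ^ k) (e - c • kap T σ Z)) := by
      nth_rewrite 1 [← pr_add_sum_up_sl x a]
      rw [nup_apply, sum_univ_eq_sum_range_pow hσ, sum_univ_eq_sum_range_pow hσ, kap_insert hx,
        neg_smul, sub_neg_eq_add, Finset.smul_sum, add_assoc, add_assoc, ← Finset.sum_add_distrib,
        ← Finset.sum_add_distrib]
      refine congrArg (pr T G x a + ·) (Finset.sum_congr rfl fun k _ => ?_)
      rw [map_add, map_sub, map_sub, map_nsmul, map_smul, smul_sub, smul_comm c k]
      abel
    have mono : rel I p Fr ∅ (insert x Z) Z ≤ rel I p Fr ∅ (insert x Z) (insert x Z) :=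
      rel_mono subset_rfl subset_rfl subset_rfl (Finset.subset_insert _ _)
    rw [main]
    refine add_mem (add_mem (idlTop_le_rel (pr_mem_idlTop (Finset.mem_insert_self _ _) ha))
      (nup_mem_rel_insert (Finset.notMem_empty x) hx (sl_mem_win hx 1 ha)))
      (sum_mem fun k _ => sub_mem (mono (up_mem_rel_empty hx hx _ (hk k))) (nsmul_mem ?_ _))
    exact mono (up_mem_rel_empty hx hx _ hc)

theorem mem_of_smul_sy_mem {t : T} {s : Finset X} {g : Grp G}
    (h : t • sy T G s g ∈ idlTop T G I) : t ∈ I := by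
  have h1 := Submodule.mem_map_of_mem (f := liftSy (T := T) (G := G) fun _ _ => (1 : T)) h
  rw [Submodule.map_smul'', map_smul, liftSy_sy _ fun _ _ _ _ => rfl] at h1
  have h2 : I • (⊤ : Submodule T (A T G Set.univ)).map (liftSy fun _ _ => (1 : T)) ≤ I :=
    (Submodule.smul_mono le_rfl le_top).trans (by simp)
  simpa using h2 h1

/-- The class of `D_Z [𝐳(Z)]` in `⨂_{z ∈ Z} (T/I)[G_{𝐳(z)}] / N_{𝐳(z)}` has zero annihilator in
`T/I`. -/
theorem mem_of_smul_kap_mem (hσ : ∀ x, ∀ g : G x, g ∈ Subgroup.zpowers (σ x))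
    (hI : ∀ x, (Fintype.card (G x) : T) ∈ I) (Z : Finset X) :
    ∀ c : T, c • kap T σ Z ∈ rel I p Fr ∅ Z Z → c ∈ I := by
  induction Z using Finset.induction_on with
  | empty =>
    intro c h
    rw [kap_empty] at h
    exact mem_of_smul_sy_mem (map_rel le_rfl 1
      (fun y _ _ hy => absurd hy (Finset.notMem_empty y))
      (fun y _ _ hy => absurd hy (Finset.notMem_empty y)) h)
  | insert x Z hx ih =>
    intro c h
    have hn := orderOf_eq_card_of_forall_mem_zpowers (hσ x)
    rw [Nat.card_eq_fintype_card] at hn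
    by_cases h1 : Fintype.card (G x) = 1
    · -- If `G_{𝐳(x)}` is trivial, then `I` is the unit ideal.
      have := hI x
      rw [h1, Nat.cast_one] at this
      simpa using I.mul_mem_left c this
    have hlt : 1 < Fintype.card (G x) := by
      have := Fintype.card_pos (α := G x)
      omega
    have hinj : ∀ i < Fintype.card (G x), ∀ j < Fintype.card (G x), σ x ^ i = σ x ^ j → i = j :=
      fun i hi j hj hij => pow_injOn_Iio_orderOf (by simpa [hn] using hi) (by simpa [hn] using hj) hij
    have hs1 : sl T x (σ x) (kap T σ (insert x Z)) = kap T σ Z := by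
      rw [kap_insert hx, map_sum, Finset.sum_eq_single 1]
      · rw [one_smul, pow_one, sl_up, pr_kap σ hx]
      · intro k hk hk1
        rw [map_nsmul, sl_up_of_ne, smul_zero]
        intro h
        exact hk1 (hinj k (Finset.mem_range.1 hk) 1 hlt (by rw [h, pow_one]))
      · simp [hlt]
    have hs0 : sl T x 1 (kap T σ (insert x Z)) = 0 := by
      rw [kap_insert hx, map_sum]
      refine Finset.sum_eq_zero fun k hk => ?_
      rcases Nat.eq_zero_or_pos k with rfl | hk0
      · simp
      · rw [map_nsmul, sl_up_of_ne, smul_zero]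
        intro h
        exact hk0.ne' (hinj k (Finset.mem_range.1 hk) 0 (by omega) (by rw [h, pow_zero]))
    have := sl_sub_sl_mem hx (σ x) 1 h
    rw [map_smul, map_smul, hs1, hs0, smul_zero, sub_zero] at this
    exact ih c this

/-! ### Invariants at a finite level -/

/-- The projection of `Q(insert x S, Z)` onto `Q(S, insert x Z)` is well defined. -/
theorem sub_pr_mem_rel_insert (hS : x ∉ S) (hZ : x ∉ Z) {a}
    (ha : a ∈ rel I p Fr (insert x S) Z Z) :
    a - pr T G x a ∈ rel I p Fr S (insert x Z) (insert x Z) := by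
  obtain ⟨c, hc, h1, -⟩ := (mem_rel_insert_iff hS hZ).1 ha
  have h2 := rel_mono subset_rfl subset_rfl subset_rfl (Finset.subset_insert x Z) h1
  simpa using sub_mem h2 (nup_mem_rel_insert (p := p) (Fr := Fr) (Z := Z) hS hZ hc)

/-- The invariants of the subquotient attached to `(S, Z)` are spanned by the classes
`D_w [𝐳(w)]` with `Z ⊆ w ⊆ S ∪ Z`. -/
theorem mem_span_kap_sup_rel (hσ : ∀ x, ∀ g : G x, g ∈ Subgroup.zpowers (σ x))
    (hI : ∀ x, (Fintype.card (G x) : T) ∈ I) (hp : ∀ x, (p x).eval 1 ∈ I) (S : Finset X) :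
    ∀ Z : Finset X, Disjoint S Z → ∀ a ∈ win T G I S Z,
      (∀ z ∈ S ∪ Z, act T G (sgElt σ z) a ∈ rel I p Fr S Z Z) →
        a ∈ Submodule.span T {b | ∃ w, Z ⊆ w ∧ w ⊆ S ∪ Z ∧ b = kap T σ w} ⊔
          rel I p Fr S Z Z := by
  induction S using Finset.induction_on with
  | empty =>
    intro Z _ a ha hinv
    obtain ⟨c, hc⟩ := exists_sub_smul_kap_mem hσ Z a ha fun z hz => hinv z (by simpa using hz)
    refine mem_of_sub_mem (Submodule.mem_sup_right hc) (Submodule.mem_sup_left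
      (Submodule.smul_mem _ _ (Submodule.subset_span ⟨Z, subset_rfl, by simp, rfl⟩)))
  | insert x S hxS ih =>
    intro Z hSZ a ha hinv
    rw [Finset.disjoint_insert_left] at hSZ
    obtain ⟨hxZ, hSZ⟩ := hSZ
    have hSxZ : Disjoint S (insert x Z) := Finset.disjoint_insert_right.2 ⟨hxS, hSZ⟩
    have hU : S ∪ insert x Z = insert x S ∪ Z := by
      rw [Finset.union_insert, Finset.insert_union]
    -- The part of `a` that involves `x` is invariant at the level `(S, insert x Z)`.
    have h1 := ih (insert x Z) hSxZ _ (sub_pr_mem_win ha) fun z hz => by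
      rw [map_sub, ← pr_act]
      exact sub_pr_mem_rel_insert hxS hxZ (hinv z (hU ▸ hz))
    obtain ⟨b, hb, d, hd, hbd⟩ := Submodule.mem_sup.1 h1
    obtain ⟨d', hd', e, he, rfl⟩ := exists_nup_of_mem_rel_insert hxZ hd
    have hb' : b ∈ Submodule.span T {b | ∃ w, Z ⊆ w ∧ w ⊆ insert x S ∪ Z ∧ b = kap T σ w} := by
      refine Submodule.span_mono ?_ hb
      rintro _ ⟨w, hw, hw', rfl⟩
      exact ⟨w, (Finset.subset_insert _ _).trans hw, hU ▸ hw', rfl⟩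
    have hbw : b ∈ win T G I S (insert x Z) := by
      refine Submodule.span_le.2 ?_ hb
      rintro _ ⟨w, hw, hw', rfl⟩
      exact kap_mem_win σ hw hw'
    have hbinv : ∀ z, act T G (sgElt σ z) b ∈ rel I p Fr (insert x S) Z Z := by
      intro z
      suffices Submodule.span T {b | ∃ w, Z ⊆ w ∧ w ⊆ insert x S ∪ Z ∧ b = kap T σ w} ≤
          (rel I p Fr (insert x S) Z Z).comap (act T G (sgElt σ z)) from this hb'
      refine Submodule.span_le.2 ?_
      rintro _ ⟨w, hw, hw', rfl⟩
      rw [SetLike.mem_coe, Submodule.mem_comap, act_sgElt]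
      exact rho_kap_sub_mem hσ hI hp w hw hw' _
    have hd'' : d' - Lam p Fr x e ∈ rel I p Fr (insert x S) Z Z :=
      sub_mem (rel_insert_le_rel_insert hd') (Lam_mem_rel hxS hxZ he)
    -- Subtracting `b` and relations from `a` leaves an invariant element not involving `x`.
    set a' := a - b - (d' - Lam p Fr x e) with ha'
    have hpa' : a' - pr T G x a' ∈ idlTop T G I := by
      have e1 : a' - pr T G x a' = pr T G x b + pr T G x d' := by
        have e2 : pr T G x a' = pr T G x a - pr T G x b -
            (pr T G x d' - act T G (evalFrob Fr x (p x)) (pr T G x e)) := by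
          rw [ha', map_sub, map_sub, map_sub, pr_Lam]
        have : a = pr T G x a + (b + (d' + nup T G x e)) := by rw [hbd]; abel
        rw [e2, ha', Lam_apply]
        nth_rewrite 1 [this]
        abel
      rw [e1]
      exact add_mem (pr_mem_idlTop (Finset.mem_insert_self _ _) hbw)
        (pr_mem_idlTop (Finset.mem_insert_self _ _) (rel_le_win hd'))
    have hinv' : ∀ z ∈ insert x S ∪ Z,
        act T G (sgElt σ z) (pr T G x a') ∈ rel I p Fr (insert x S) Z Z := by
      intro z hz
      refine mem_of_sub_mem' (a := act T G (sgElt σ z) a') ?_ ?_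
      · rw [← map_sub]
        exact idlTop_le_rel (map_idlTop _ hpa')
      · rw [ha', map_sub, map_sub]
        exact sub_mem (sub_mem (hinv z hz) (hbinv z)) (act_mem_rel _ hd'')
    have hwin : pr T G x a' ∈ win T G I S Z := by
      refine pr_mem_win (sub_mem (sub_mem ha ?_) (rel_le_win hd''))
      exact win_mono (Finset.subset_insert _ _) (hU ▸ subset_rfl) hbw
    have h2 := ih Z hSZ _ hwin fun z hz =>
      mem_rel_of_mem_rel_insert hσ hSZ hxS hxZ subset_rfl (act_mem_win _ hwin)
        (hinv' z (Finset.union_subset_union_left (Finset.subset_insert _ _) hz))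
    have h3 : pr T G x a' ∈ Submodule.span T
        {b | ∃ w, Z ⊆ w ∧ w ⊆ insert x S ∪ Z ∧ b = kap T σ w} ⊔ rel I p Fr (insert x S) Z Z := by
      refine SetLike.le_def.1 (sup_le_sup (Submodule.span_mono ?_) rel_le_rel_insert) h2
      rintro _ ⟨w, hw, hw', rfl⟩
      exact ⟨w, hw, hw'.trans (Finset.union_subset_union_left (Finset.subset_insert _ _)), rfl⟩
    have : a = (a' - pr T G x a') + pr T G x a' + b + (d' - Lam p Fr x e) := by rw [ha']; abel
    rw [this]
    exact add_mem (add_mem (add_mem (Submodule.mem_sup_right (idlTop_le_rel hpa')) h3)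
      (Submodule.mem_sup_left hb')) (Submodule.mem_sup_right hd'')

/-- The classes `D_w [𝐳(w)]` with `Z ⊆ w ⊆ S ∪ Z` are linearly independent over `T/I` in the
subquotient attached to `(S, Z)`. -/
theorem mem_of_sum_smul_kap_mem (hσ : ∀ x, ∀ g : G x, g ∈ Subgroup.zpowers (σ x))
    (hI : ∀ x, (Fintype.card (G x) : T) ∈ I) (S : Finset X) :
    ∀ (Z : Finset X) (c : Finset X → T), Disjoint S Z →
      ∑ w ∈ S.powerset, c w • kap T σ (w ∪ Z) ∈ rel I p Fr S Z Z → ∀ w ⊆ S, c w ∈ I := by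
  induction S using Finset.induction_on with
  | empty =>
    intro Z c _ h w hw
    obtain rfl := Finset.subset_empty.1 hw
    refine mem_of_smul_kap_mem (p := p) (Fr := Fr) hσ hI Z _ ?_
    simpa using h
  | insert x S hxS ih =>
    intro Z c hSZ h
    rw [Finset.disjoint_insert_left] at hSZ
    obtain ⟨hxZ, hSZ⟩ := hSZ
    have hSxZ : Disjoint S (insert x Z) := Finset.disjoint_insert_right.2 ⟨hxS, hSZ⟩
    have hx : ∀ w ∈ S.powerset, x ∉ w ∪ Z := fun w hw h =>
      (Finset.mem_union.1 h).elim (fun h => hxS (Finset.mem_powerset.1 hw h)) hxZ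
    have hins : ∀ w : Finset X, insert x w ∪ Z = w ∪ insert x Z := fun w => by
      rw [Finset.union_insert, Finset.insert_union]
    rw [Finset.sum_powerset_insert hxS] at h
    have e0 : pr T G x (∑ w ∈ S.powerset, c w • kap T σ (w ∪ Z)) =
        ∑ w ∈ S.powerset, c w • kap T σ (w ∪ Z) := by
      rw [map_sum]
      exact Finset.sum_congr rfl fun w hw => by rw [map_smul, pr_kap σ (hx w hw)]
    have e1 : pr T G x (∑ w ∈ S.powerset, c (insert x w) • kap T σ (insert x w ∪ Z)) = 0 := by
      rw [map_sum]
      refine Finset.sum_eq_zero fun w _ => ?_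
      rw [map_smul, pr_kap_mem σ (by simp), smul_zero]
    have h1 := sub_pr_mem_rel_insert hxS hxZ h
    rw [map_add, e0, e1, add_zero, add_sub_cancel_left] at h1
    simp only [hins] at h1
    have hc1 := ih (insert x Z) (fun w => c (insert x w)) hSxZ h1
    have h2 : ∑ w ∈ S.powerset, c w • kap T σ (w ∪ Z) ∈ rel I p Fr (insert x S) Z Z := by
      refine (add_mem_cancel_right (sum_mem fun w hw => ?_)).1 h
      exact idlTop_le_rel (smul_mem_idlTop (hc1 w (Finset.mem_powerset.1 hw)) _)
    have h3 := mem_rel_of_mem_rel_insert hσ hSZ hxS hxZ subset_rfl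
      (sum_mem fun w hw => Submodule.smul_mem _ _ (kap_mem_win σ Finset.subset_union_right
        (Finset.union_subset_union_left (Finset.mem_powerset.1 hw)))) h2
    have hc0 := ih Z c hSZ h3
    intro w hw
    by_cases hxw : x ∈ w
    · rw [← Finset.insert_erase hxw]
      exact hc1 _ (Finset.subset_insert_iff.1 hw)
    · exact hc0 w ((Finset.subset_insert_iff_of_notMem hxw).1 hw)

end

end Kolyvagin

section Invariants

variable {T : Type*} [CommRing T] {X : Type*} {G : X → Type*} [∀ x, CommGroup (G x)]
  [DecidableEq X] [∀ x, Fintype (G x)]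
  {I : Ideal T} {p : X → Polynomial T} {Fr : X → Grp G}

/-! ### Passage to the universal norm distribution -/

theorem rel_empty_mono {S S' : Finset X} (h : S ⊆ S') :
    rel I p Fr S ∅ ∅ ≤ rel I p Fr S' ∅ ∅ :=
  rel_mono h subset_rfl (Finset.union_subset_union_left h) subset_rfl

theorem exists_mem_win_empty (a : A T G Set.univ) : ∃ S : Finset X, a ∈ win T G I S ∅ := by
  induction a using Finsupp.induction_linear with
  | zero => exact ⟨∅, zero_mem _⟩
  | add a b ha hb =>
    obtain ⟨S, hS⟩ := ha
    obtain ⟨S', hS'⟩ := hb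
    exact ⟨S ∪ S', add_mem
      (win_mono subset_rfl (Finset.union_subset_union_left Finset.subset_union_left) hS)
      (win_mono subset_rfl (Finset.union_subset_union_left Finset.subset_union_right) hS')⟩
  | single s t =>
    refine ⟨s.supp, ?_⟩
    rw [← mul_one t, ← smul_eq_mul, ← Finsupp.smul_single, exists_sy_eq_single]
    exact Submodule.smul_mem _ _ (sy_mem_win (Finset.empty_subset _) (by simp))

theorem sgElt_mem_idlTop_of_notMem {σ : ∀ x, G x} {S Y : Finset X} {z : X} (hS : z ∉ S)
    (hY : z ∉ Y) {a} (ha : a ∈ win T G I S Y) : act T G (sgElt σ z) a ∈ idlTop T G I := by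
  refine map_win le_rfl _ (fun s g hs hs' => ?_) ha
  have hz := notMem_window hS hY hs'
  have : rho T G (Pi.mulSingle z (σ z)) (sy T G s g) = sy T G s g := by
    rw [rho_sy]
    refine sy_congr _ fun y hy => ?_
    have : y ≠ z := fun h => hz (h ▸ hy)
    simp [this]
  rw [act_sgElt, this, sub_self]
  exact zero_mem _

/-- The relations of `𝒰_𝐳` modulo `I` are the union of the relations at finite levels. -/
theorem mem_relD_sup_iff {a} :
    a ∈ relD p Fr Set.univ ⊔ idlTop T G I ↔ ∃ S : Finset X, a ∈ rel I p Fr S ∅ ∅ := by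
  constructor
  · intro h
    obtain ⟨b, hb, j, hj, rfl⟩ := Submodule.mem_sup.1 h
    suffices ∃ S : Finset X, b ∈ rel I p Fr S ∅ ∅ by
      obtain ⟨S, hS⟩ := this
      exact ⟨S, add_mem hS (idlTop_le_rel hj)⟩
    refine Submodule.span_induction ?_ ⟨∅, zero_mem _⟩ ?_ ?_ hb
    · rintro _ ⟨x, _, s, _, g, hx, rfl⟩
      refine ⟨insert x s, ?_⟩
      have e := Lam_sy p Fr hx g
      change _ = lam p Fr x (Set.mem_univ x) s (Set.subset_univ _) g at e
      rw [← e]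
      exact Lam_sy_mem_rel (Finset.mem_insert_self _ _) hx (Finset.empty_subset _)
        ((Finset.subset_insert _ _).trans Finset.subset_union_left)
    · rintro a b _ _ ⟨S, hS⟩ ⟨S', hS'⟩
      exact ⟨S ∪ S', add_mem (rel_empty_mono Finset.subset_union_left hS)
        (rel_empty_mono Finset.subset_union_right hS')⟩
    · rintro t a _ ⟨S, hS⟩
      exact ⟨S, Submodule.smul_mem _ _ hS⟩
  · rintro ⟨S, hS⟩
    refine map_rel le_sup_right 1 (fun y s g _ hys _ _ => Submodule.mem_sup_left ?_)
      (fun z _ _ hz => absurd hz (Finset.notMem_empty z)) hS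
    exact Submodule.subset_span
      ⟨y, Set.mem_univ y, s, Set.subset_univ _, g, hys, Lam_sy p Fr hys g⟩

variable {O : Type*} [CommRing O] [Algebra O T] {M : O}

variable (p Fr M) in
/-- The projection `𝒜_𝐳 → 𝒰_𝐳 / M 𝒰_𝐳`. -/
def cl : A T G Set.univ →ₗ[T] UMod p Fr M :=
  (Submodule.mkQ _).comp (Submodule.mkQ (relD p Fr Set.univ))

theorem cl_surjective : Function.Surjective (cl p Fr M) :=
  (Submodule.mkQ_surjective _).comp (Submodule.mkQ_surjective _)

theorem cl_eq_zero_iff {a} :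
    cl p Fr M a = 0 ↔ ∃ S : Finset X, a ∈ rel (idl T M) p Fr S ∅ ∅ := by
  rw [← mem_relD_sup_iff, ← Submodule.comap_map_mkQ, Submodule.mem_comap, Submodule.map_smul'',
    Submodule.map_top, Submodule.range_mkQ]
  exact Submodule.Quotient.mk_eq_zero _

theorem repUMod_cl (g : Grp G) (a) : repUMod p Fr M g (cl p Fr M a) = cl p Fr M (rho T G g a) :=
  rfl

theorem repU_asAlgebraHom_mk (f : MonoidAlgebra T (Grp G)) (a : A T G Set.univ) :
    (repU p Fr Set.univ).asAlgebraHom f (Submodule.Quotient.mk a) =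
      Submodule.Quotient.mk (act T G f a) := by
  induction f using MonoidAlgebra.induction_on with
  | of g =>
    rw [act_single, Representation.asAlgebraHom_of]
    rfl
  | add f f' h h' =>
    simp only [act, map_add, LinearMap.add_apply, Submodule.Quotient.mk_add] at *
    rw [h, h']
  | smul t f h =>
    simp only [act, map_smul, LinearMap.smul_apply, Submodule.Quotient.mk_smul] at *
    rw [h]

theorem kolyClass_eq_cl (σ : ∀ x, G x) (y : Finset X) :
    kolyClass p Fr M σ y = cl p Fr M (kap T σ y) := by
  rw [kolyClass, repU_asAlgebraHom_mk]
  rfl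

theorem mem_H0_iff {a} : cl p Fr M a ∈ H0 p Fr M ↔
    ∀ g, ∃ S : Finset X, rho T G g a - a ∈ rel (idl T M) p Fr S ∅ ∅ := by
  refine forall_congr' fun g => ?_
  rw [← cl_eq_zero_iff, map_sub, sub_eq_zero, repUMod_cl]

variable {σ : ∀ x, G x}

theorem kolyClass_mem_H0 (hσ : ∀ x, ∀ g : G x, g ∈ Subgroup.zpowers (σ x))
    (hI : ∀ x, (Fintype.card (G x) : T) ∈ idl T M) (hp : ∀ x, (p x).eval 1 ∈ idl T M)
    (y : Finset X) : kolyClass p Fr M σ y ∈ H0 p Fr M := by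
  rw [kolyClass_eq_cl, mem_H0_iff]
  exact fun g => ⟨y, rho_kap_sub_mem hσ hI hp y (Finset.empty_subset _) (by simp) g⟩

theorem mem_span_kolyClass (hσ : ∀ x, ∀ g : G x, g ∈ Subgroup.zpowers (σ x))
    (hI : ∀ x, (Fintype.card (G x) : T) ∈ idl T M) (hp : ∀ x, (p x).eval 1 ∈ idl T M)
    {u : UMod p Fr M} (hu : u ∈ H0 p Fr M) :
    u ∈ Submodule.span (T ⧸ idl T M) (Set.range (kolyClass p Fr M σ)) := by
  obtain ⟨a, rfl⟩ := cl_surjective u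
  obtain ⟨S₁, hS₁⟩ := exists_mem_win_empty (I := idl T M) a
  choose s hs using mem_H0_iff.1 hu
  -- A finite level that sees `a` together with its invariance under every `σ_{𝐳(z)}`, `z ∈ S₁`.
  set S := S₁ ∪ S₁.biUnion fun z => s (Pi.mulSingle z (σ z)) with hS
  have hwin : a ∈ win T G (idl T M) S ∅ :=
    win_mono subset_rfl (Finset.union_subset_union_left Finset.subset_union_left) hS₁
  have hinv : ∀ z ∈ S ∪ ∅, act T G (sgElt σ z) a ∈ rel (idl T M) p Fr S ∅ ∅ := by
    intro z _
    by_cases hz : z ∈ S₁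
    · rw [act_sgElt]
      refine rel_empty_mono ?_ (hs _)
      exact (Finset.subset_biUnion_of_mem (fun z => s (Pi.mulSingle z (σ z))) hz).trans
        Finset.subset_union_right
    · exact idlTop_le_rel (sgElt_mem_idlTop_of_notMem hz (Finset.notMem_empty z) hS₁)
  obtain ⟨b, hb, d, hd, rfl⟩ := Submodule.mem_sup.1
    (mem_span_kap_sup_rel hσ hI hp S ∅ (Finset.disjoint_empty_right S) a hwin hinv)
  rw [map_add, cl_eq_zero_iff.2 ⟨S, hd⟩, add_zero]
  refine Submodule.span_induction ?_ ?_ ?_ ?_ hb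
  · rintro _ ⟨w, _, _, rfl⟩
    rw [← kolyClass_eq_cl]
    exact Submodule.subset_span ⟨w, rfl⟩
  · rw [map_zero]
    exact zero_mem _
  · intro b b' _ _ h h'
    rw [map_add]
    exact add_mem h h'
  · intro t b _ h
    rw [map_smul]
    exact Submodule.smul_mem _ (Ideal.Quotient.mk (idl T M) t) h

theorem linearIndependent_kolyClass (hσ : ∀ x, ∀ g : G x, g ∈ Subgroup.zpowers (σ x))
    (hI : ∀ x, (Fintype.card (G x) : T) ∈ idl T M) :
    LinearIndependent (T ⧸ idl T M) (kolyClass p Fr M σ) := by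
  rw [linearIndependent_iff']
  intro s g hg
  choose c hc using fun w => Ideal.Quotient.mk_surjective (g w)
  have h1 : cl p Fr M (∑ w ∈ s, c w • kap T σ w) = 0 := by
    rw [← hg, map_sum]
    refine Finset.sum_congr rfl fun w _ => ?_
    rw [map_smul, kolyClass_eq_cl, ← hc]
    rfl
  obtain ⟨S', hS'⟩ := cl_eq_zero_iff.1 h1
  set S := S' ∪ s.biUnion id with hS
  have hsS : ∀ w ∈ s, w ⊆ S := fun w hw =>
    (Finset.subset_biUnion_of_mem id hw).trans Finset.subset_union_right
  have h2 : ∑ w ∈ S.powerset, (if w ∈ s then c w else 0) • kap T σ (w ∪ ∅) ∈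
      rel (idl T M) p Fr S ∅ ∅ := by
    have : ∑ w ∈ S.powerset, (if w ∈ s then c w else 0) • kap T σ (w ∪ ∅) =
        ∑ w ∈ s, c w • kap T σ w := by
      symm
      refine Finset.sum_subset_zero_on_sdiff (fun w hw => Finset.mem_powerset.2 (hsS w hw))
        (fun w hw => ?_) (fun w hw => ?_)
      · rw [if_neg (Finset.mem_sdiff.1 hw).2, zero_smul]
      · rw [if_pos hw, Finset.union_empty]
    rw [this]
    exact rel_empty_mono Finset.subset_union_left hS'
  intro w hw
  have h3 := mem_of_sum_smul_kap_mem hσ hI S ∅ _ (Finset.disjoint_empty_right S) h2 w (hsS w hw)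
  rw [if_pos hw] at h3
  rw [← hc]
  exact Ideal.Quotient.eq_zero_iff_mem.2 h3

end Invariants

end

end NormDist

theorem mainTheorem2
    {O : Type*} [CommRing O] [IsDomain O]
    {T : Type*} [CommRing T] [Algebra O T] [Module.Finite O T] [Module.IsTorsionFree O T]
    {X : Type*} [DecidableEq X]
    (G : X → Type*) [∀ x, CommGroup (G x)] [∀ x, Fintype (G x)]
    (p : X → Polynomial T) (Fr : X → NormDist.Grp G)
    (r : X → Polynomial O) (M : O)
    (hcard : ∀ x, M ∣ (Fintype.card (G x) : O))
    (hp : ∀ x, algebraMap O T M ∣ (p x).eval 1)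
    (σ : ∀ x, G x) (hσ : ∀ x, ∀ g : G x, g ∈ Subgroup.zpowers (σ x))
    (hγ : ∀ x, Function.Injective (NormDist.gam p Fr (r x) x)) :
    ∃ b : Module.Basis (Finset X) (T ⧸ NormDist.idl T M) (NormDist.H0 p Fr M),
      ∀ y : Finset X, (b y : NormDist.UMod p Fr M) = NormDist.kolyClass p Fr M σ y := by
  have hI : ∀ x, (Fintype.card (G x) : T) ∈ NormDist.idl T M := fun x => by
    rw [Ideal.mem_span_singleton]
    simpa using map_dvd (algebraMap O T) (hcard x)
  have hp' : ∀ x, (p x).eval 1 ∈ NormDist.idl T M := fun x => Ideal.mem_span_singleton.2 (hp x)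
  let v : Finset X → NormDist.H0 p Fr M := fun y =>
    ⟨NormDist.kolyClass p Fr M σ y, NormDist.kolyClass_mem_H0 hσ hI hp' y⟩
  have hv : (NormDist.H0 p Fr M).subtype ∘ v = NormDist.kolyClass p Fr M σ := rfl
  have hli : LinearIndependent (T ⧸ NormDist.idl T M) v := by
    refine LinearIndependent.of_comp (NormDist.H0 p Fr M).subtype ?_
    rw [hv]
    exact NormDist.linearIndependent_kolyClass hσ hI
  have hsp : ⊤ ≤ Submodule.span (T ⧸ NormDist.idl T M) (Set.range v) := by
    rintro u -
    have hu := NormDist.mem_span_kolyClass hσ hI hp' u.2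
    rw [← hv, Set.range_comp, ← Submodule.map_span] at hu
    obtain ⟨u', hu', e⟩ := hu
    rwa [← Subtype.ext e]
  exact ⟨Module.Basis.mk hli hsp, fun y => by rw [Module.Basis.mk_apply]⟩
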